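/- Let $H$ be a finite group, let $\chi$ be an irreducible complex character of $H$, and put $d=\chi(1)$ and $\zeta_n=e^{2\pi i/n}$. For each prime $p$ fix an algebraically closed field $k_p$ of characteristic $p$ and, if $p\nmid|H|$, an identification (a group isomorphism) of the $|H|$-th roots of unity in $k_p$ with those in $\mathbb{C}$. The Brauer character of a representation $\rho:H\to\mathrm{GL}_d(k_p)$ with $p\nmid|H|$ sends $h$ to the sum, with multiplicity, of the complex numbers corresponding to the eigenvalues of $\rho(h)$. For a power $q=p^a$ ($a\ge 1$), let $\mathrm{GL}_d(q)\le\mathrm{GL}_d(k_p)$ be the group of invertible $d\times d$ matrices over the subfield of $k_p$ with $q$ elements. For a prime $p\nmid |H|$, let $\bar H\le \mathrm{GL}_d(k_p)$ denote the image of a representation of $H$ with Brauer character $\chi$ (it exists and is unique up to conjugacy). A positive integer $n$ is a distinguishing modulus for $(H,\chi)$ if, for every prime power $q=p^a$ that is prime to $|H|$ and satisfies $q\equiv 1 \pmod n$, the group $\bar H$ is conjugate in $\mathrm{GL}_d(k_p)$ to a subgroup of $\mathrm{GL}_d(q)$. Then: 1. A positive integer $n$ is a distinguishing modulus for $(H,\chi)$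 if and only if $\chi(h)\in\mathbb{Q}(\zeta_n)$ for all $h\in H$. 2. There is a smallest distinguishing modulus $n_0$ for $(H,\chi)$ (the principal modulus), and every distinguishing modulus for $(H,\chi)$ is a multiple of $n_0$. 3. A positive integer $m$ is a distinguishing modulus for $(H,\chi)$ if and only if $\gcd(m,|H|)$ is. -/

import Mathlib

noncomputable section

instance instFactPrimeCoePrimes (p : Nat.Primes) : Fact (p : ℕ).Prime := ⟨p.2⟩

/-- `χ` is the character of an irreducible complex representation of `H`. -/
def IsIrreducibleCharacter {H : Type*} [Group H] (χ : H → ℂ) : Prop :=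
  ∃ (d : ℕ) (σ : Representation ℂ H (Fin d → ℂ)), σ.IsIrreducible ∧ σ.character = χ

/-- The `n`-th cyclotomic field `ℚ(ζₙ)` inside `ℂ`, where `ζₙ = exp(2πi/n)`. -/
def cyclotomicSubfield (n : ℕ) : IntermediateField ℚ ℂ :=
  IntermediateField.adjoin ℚ {Complex.exp (2 * Real.pi * Complex.I / n)}

/-- For a field `k` of prime characteristic `p` and `q = p ^ a`, the subfield of all `x` in `k` with
`x ^ q = x`. If `k` is algebraically closed and `0 < a`, this is the subfield of `k` with `q`
elements. -/
def fieldOfOrder (k : Type*) [Field k] (p : ℕ) [Fact p.Prime] [CharP k p] (a : ℕ) : Subfield k :=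
  RingHom.eqLocusField (iterateFrobenius k p a) (RingHom.id k)

/-- `GL_d(q)` as a subgroup of `GL_d(k)`, where `q = p ^ a`: the invertible matrices over the
subfield of order `q`. -/
def generalLinearOfOrder (k : Type*) [Field k] (p : ℕ) [Fact p.Prime] [CharP k p] (a d : ℕ) :
    Subgroup (GL (Fin d) k) :=
  (Matrix.GeneralLinearGroup.map (n := Fin d) (fieldOfOrder k p a).subtype).range

open Classical in
/-- The lift to `ℂ` of an `N`-th root of unity of `k`, through a homomorphism `φ` (which will be
injective). The value at elements that are not `N`-th roots of unity is never used. -/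
def liftRoot {k : Type*} [Field k] {N : ℕ} (φ : rootsOfUnity N k →* ℂˣ) (x : k) : ℂ :=
  if h : ∃ u : rootsOfUnity N k, ((u : kˣ) : k) = x then (φ h.choose : ℂ) else 0

/-- The Brauer character of `ρ : H → GL_d(k)`, when the characteristic of the algebraically closed
field `k` does not divide `|H|`: the sum of the lifts to `ℂ` of the eigenvalues of `ρ h`, counted
with multiplicity. The eigenvalues are `|H|`-th roots of unity. -/
def brauerCharacter {H : Type*} [Group H] {k : Type*} [Field k]
    (φ : rootsOfUnity (Nat.card H) k →* ℂˣ) {d : ℕ} (ρ : H →* GL (Fin d) k) (h : H) : ℂ :=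
  ((Matrix.charpoly (ρ h : Matrix (Fin d) (Fin d) k)).roots.map (liftRoot φ)).sum

/-- `n` is a distinguishing modulus for `H` and `χ`, relative to a choice, for each prime `p`, of an
algebraically closed field `k p` of characteristic `p` and of an identification `φ p` of the
`|H|`-th roots of unity of `k p` with complex ones: `n` is positive and, for every prime power
`q = p ^ a` that is prime to `|H|` and congruent to `1` modulo `n`, the image of `H` in `GL_d(k p)`
under a representation with Brauer character `χ` is conjugate in `GL_d(k p)` to a subgroup of
`GL_d(q)`. Evaluating at `1` shows that the degree `d` can only be `χ 1`. -/
def IsDistinguishingModulus {H : Type*} [Group H] (k : Nat.Primes → Type*) [∀ p, Field (k p)]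
    [∀ p, CharP (k p) p] (φ : ∀ p, rootsOfUnity (Nat.card H) (k p) →* ℂˣ) (χ : H → ℂ) (n : ℕ) :
    Prop :=
  0 < n ∧ ∀ (p : Nat.Primes) (a : ℕ), 0 < a → ¬ (p : ℕ) ∣ Nat.card H → (p : ℕ) ^ a ≡ 1 [MOD n] →
    ∀ (d : ℕ) (ρ : H →* GL (Fin d) (k p)), brauerCharacter (φ p) ρ = χ →
      ∃ g : GL (Fin d) (k p), ∀ h : H, g * ρ h * g⁻¹ ∈ generalLinearOfOrder (k p) p a d

end

/-! Claim 1 carries the rest. Given it, the moduli are the positive n for which χ has values in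
ℚ(ζ_n). They are closed under multiples and, because ℚ(ζ_m) ∩ ℚ(ζ_n) = ℚ(ζ_gcd(m,n)), under gcds.
Also |H| is one of them, since eigenvalues are |H|-th roots of unity. Claims 2 and 3 follow.

Suppose χ has values in ℚ(ζ_n). Reducing a complex model of χ modulo p gives a representation S over
k_p (`exists_reduction`). Schur orthogonality, written without division, survives reduction and
shows that S is full because p ∤ |H|. If q ≡ 1 mod n, the automorphism ζ ↦ ζ^q fixes χ, so S and its
q-Frobenius twist have equal traces. The trace pairing equals |H| ≠ 0 in k_p, so averaging produces
a T conjugating S to its twist; the same argument shows that any representation with Brauer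
character χ is conjugate to S. There is no Schur index obstruction: v ↦ T⁻¹F(v) is a
Frobenius-semilinear injection, hence has a nonzero fixed vector. Its H-translates are fixed too and
span by fullness, and in a basis of them S has entries in the field with q elements.

Conversely, let n be distinguishing, t prime to n|H| and t ≡ 1 mod n. Dirichlet gives a prime p ∤
|H| with p ≡ t mod n|H|. Conjugacy into GL_d(p) makes the eigenvalues of each element stable under
p-th powers, so ζ ↦ ζ^t fixes χ(h). Galois theory of ℚ(ζ_{n|H|}) puts χ(h) in ℚ(ζ_n). -/

noncomputable section

open Matrix

/-! ### Fixed vectors of Frobenius-semilinear maps -/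

/-- A nonzero finite-dimensional space over an algebraically closed field has a nonzero vector fixed
by any additive injection that is semilinear for the `q`-th power map. -/
theorem exists_ne_zero_fixed_of_powSemilinear {k V : Type*} [Field k] [IsAlgClosed k]
    [AddCommGroup V] [Module k V] [FiniteDimensional k V] {q : ℕ} (hq : 2 ≤ q) (ψ : V →+ V)
    (hsmul : ∀ (c : k) (v : V), ψ (c • v) = c ^ q • ψ v) (hinj : ∀ v, ψ v = 0 → v = 0)
    {v : V} (hv : v ≠ 0) : ∃ w, w ≠ 0 ∧ ψ w = w := by
  classical
  let y : ℕ → V := fun i => ψ^[i] v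
  have hysucc : ∀ i, ψ (y i) = y (i + 1) := fun i => (Function.iterate_succ_apply' ψ i v).symm
  have hyne : ∀ i, y i ≠ 0 := by
    intro i
    induction i with
    | zero => exact hv
    | succ i ih => exact fun h => ih (hinj _ ((hysucc i).trans h))
  have hex : ∃ r, y r ∈ Submodule.span k (y '' Set.Iio r) := by
    by_contra! hcon
    have hli : ∀ m, LinearIndepOn k y (Set.Iio m) := by
      intro m
      induction m with
      | zero => simp
      | succ m ih =>
        have : Set.Iio (m + 1) = insert m (Set.Iio m) := by ext; simp
        rw [this, linearIndepOn_insert (by simp)]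
        exact ⟨ih, hcon m⟩
    have h := (hli (Module.finrank k V + 1)).fintype_card_le_finrank
    simp at h
  have hr := Nat.find_spec hex
  have hmin : ∀ m < Nat.find hex, y m ∉ Submodule.span k (y '' Set.Iio m) :=
    fun m hm => Nat.find_min hex hm
  obtain ⟨r, hrdef⟩ : ∃ r, Nat.find hex = r := ⟨_, rfl⟩
  rw [hrdef] at hr hmin
  have hcoef : ∃ a : ℕ → k, y r = ∑ i ∈ Finset.range r, a i • y i := by
    have : y '' Set.Iio r = y '' (Finset.range r : Set ℕ) := by simp
    rw [this, Submodule.mem_span_image_finset_iff_exists_fun] at hr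
    obtain ⟨c, hc⟩ := hr
    refine ⟨fun i => if h : i ∈ Finset.range r then c ⟨i, h⟩ else 0, ?_⟩
    rw [← hc]
    refine Eq.trans (Finset.sum_congr rfl fun i _ => ?_) (Finset.sum_coe_sort (Finset.range r)
      (fun i => (if h : i ∈ Finset.range r then c ⟨i, h⟩ else 0) • y i))
    rw [dif_pos i.2]
  obtain ⟨a, ha⟩ := hcoef
  -- Look for w = ∑_{i<r} c_{i+1} y_i. Using the relation for y_r, ψ w = w holds if c_0 = 0, c_{i+1}
  -- = c_i^q + a_i x^q and c_r = x. Here `C' i` is c_i as a polynomial in x, so a nonzero x with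
  -- C'_r(x) = x is needed.
  open Polynomial in
  let C' : ℕ → k[X] := fun i => Nat.rec 0 (fun i c => c ^ q + C (a i) * X ^ q) i
  have hC0 : C' 0 = 0 := rfl
  have hCs : ∀ i, C' (i + 1) = C' i ^ q + Polynomial.C (a i) * Polynomial.X ^ q := fun i => rfl
  have hdvd : ∀ i, Polynomial.X ^ 2 ∣ C' i := by
    intro i
    induction i with
    | zero => simp [hC0]
    | succ i ih =>
      rw [hCs]
      refine dvd_add (ih.trans (dvd_pow_self _ (by omega))) ?_
      exact Dvd.dvd.mul_left (pow_dvd_pow _ hq) _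
  -- Since X^{2q} divides C'_i^q, the coefficient of X^q in C'_{i+1} is a_i. So C'_r = 0 would force
  -- y_r = 0.
  have hzero : ∀ i, C' i = 0 → ∀ j < i, a j = 0 := by
    intro i
    induction i with
    | zero => intro _ j hj; omega
    | succ i ih =>
      intro h
      rw [hCs] at h
      have h1 : Polynomial.X ^ (2 * q) ∣ C' i ^ q := by
        rw [pow_mul]; exact pow_dvd_pow_of_dvd (hdvd i) q
      have hai : a i = 0 := by
        have h2 := congrArg (fun P => Polynomial.coeff P q) h
        have h3 := Polynomial.X_pow_dvd_iff.mp h1 q (by omega)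
        simpa [h3] using h2
      rw [hai] at h
      have h4 : C' i = 0 := by
        have : C' i ^ q = 0 := by simpa using h
        exact eq_zero_of_pow_eq_zero this
      intro j hj
      rcases Nat.lt_succ_iff_lt_or_eq.mp hj with hj | rfl
      · exact ih h4 j hj
      · exact hai
  have hCr : C' r ≠ 0 := by
    intro h
    have h1 := hzero r h
    apply hyne r
    rw [ha]
    exact Finset.sum_eq_zero fun i hi => by rw [h1 i (Finset.mem_range.mp hi), zero_smul]
  obtain ⟨D, hD⟩ := hdvd r
  have hD0 : D ≠ 0 := by rintro rfl; exact hCr (by simpa using hD)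
  -- With C'_r = X²D, a root of XD - 1 solves C'_r(x) = x and is automatically nonzero.
  obtain ⟨x, hx⟩ := IsAlgClosed.exists_root (Polynomial.X * D - 1) (by
    have h1 : (Polynomial.X * D).natDegree = D.natDegree + 1 := Polynomial.natDegree_X_mul hD0
    have h2 : (1 : Polynomial k).degree < (Polynomial.X * D).degree := by
      rw [Polynomial.degree_one, ← Polynomial.natDegree_pos_iff_degree_pos]; omega
    rw [Polynomial.degree_sub_eq_left_of_degree_lt h2]
    exact (lt_of_le_of_lt (by simp) h2).ne')
  have hxD : x * D.eval x = 1 := by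
    have : x * D.eval x - 1 = 0 := by simpa [Polynomial.IsRoot] using hx
    exact sub_eq_zero.mp this
  have hx0 : x ≠ 0 := by rintro rfl; simp at hxD
  let c : ℕ → k := fun i => (C' i).eval x
  have hc0 : c 0 = 0 := by simp [c, hC0]
  have hcs : ∀ i, c (i + 1) = c i ^ q + a i * x ^ q := fun i => by simp [c, hCs]
  have hcr : c r = x := by
    simp only [c, hD, Polynomial.eval_mul, Polynomial.eval_pow, Polynomial.eval_X]
    rw [pow_two, mul_assoc, hxD, mul_one]
  have hr0 : r ≠ 0 := by rintro rfl; exact hx0 (hcr.symm.trans hc0)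
  obtain ⟨s, rfl⟩ := Nat.exists_eq_succ_of_ne_zero hr0
  refine ⟨∑ i ∈ Finset.range (s + 1), c (i + 1) • y i, ?_, ?_⟩
  · intro h
    rw [Finset.sum_range_succ, hcr] at h
    apply hmin s (Nat.lt_succ_self s)
    have h1 : x • y s ∈ Submodule.span k (y '' Set.Iio s) := by
      rw [eq_neg_of_add_eq_zero_right h]
      refine neg_mem (sum_mem fun i hi => Submodule.smul_mem _ _ (Submodule.subset_span ?_))
      exact ⟨i, Finset.mem_range.mp hi, rfl⟩
    exact (Submodule.smul_mem_iff _ hx0).mp h1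
  · have h0q : (0 : k) ^ q = 0 := zero_pow (by omega)
    calc ψ (∑ i ∈ Finset.range (s + 1), c (i + 1) • y i)
        = ∑ i ∈ Finset.range (s + 1), c (i + 1) ^ q • y (i + 1) := by
          rw [map_sum]; exact Finset.sum_congr rfl fun i _ => by rw [hsmul, hysucc]
      _ = ∑ i ∈ Finset.range (s + 1 + 1), c i ^ q • y i := by
          rw [Finset.sum_range_succ' _ (s + 1), hc0, h0q, zero_smul, add_zero]
      _ = ∑ i ∈ Finset.range (s + 1), c i ^ q • y i + x ^ q • y (s + 1) := by
          rw [Finset.sum_range_succ, hcr]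
      _ = ∑ i ∈ Finset.range (s + 1), c (i + 1) • y i := by
          rw [ha, Finset.smul_sum, ← Finset.sum_add_distrib]
          refine Finset.sum_congr rfl fun i _ => ?_
          rw [hcs, smul_smul, ← add_smul, mul_comm (a i)]

/-! ### Full representations: descent to a finite field and conjugacy -/

/-- A matrix representation is full if its values span the whole matrix algebra. -/
def IsFullRepresentation {H k : Type*} [Group H] [Field k] {d : ℕ} (S : H →* GL (Fin d) k) : Prop :=
  Submodule.span k (Set.range fun h => (S h : Matrix (Fin d) (Fin d) k)) = ⊤

theorem mem_generalLinearOfOrder_iff {k : Type*} [Field k] {p : ℕ} [Fact p.Prime] [CharP k p]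
    {a d : ℕ} (x : GL (Fin d) k) :
    x ∈ generalLinearOfOrder k p a d ↔
      Matrix.GeneralLinearGroup.map (n := Fin d) (iterateFrobenius k p a) x = x := by
  constructor
  · rintro ⟨y, rfl⟩
    ext i j
    exact (y i j).2
  · intro h
    have hmem : ∀ i j, (x : Matrix (Fin d) (Fin d) k) i j ∈ fieldOfOrder k p a := by
      intro i j
      exact congrArg (fun z : GL (Fin d) k => (z : Matrix (Fin d) (Fin d) k) i j) h
    have h' : Matrix.GeneralLinearGroup.map (n := Fin d) (iterateFrobenius k p a) x⁻¹ = x⁻¹ := by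
      rw [map_inv, h]
    have hmem' : ∀ i j, ((x⁻¹ : GL (Fin d) k) : Matrix (Fin d) (Fin d) k) i j ∈
        fieldOfOrder k p a := by
      intro i j
      exact congrArg (fun z : GL (Fin d) k => (z : Matrix (Fin d) (Fin d) k) i j) h'
    let y : Matrix (Fin d) (Fin d) (fieldOfOrder k p a) := fun i j => ⟨_, hmem i j⟩
    let y' : Matrix (Fin d) (Fin d) (fieldOfOrder k p a) := fun i j => ⟨_, hmem' i j⟩
    have hy : (fieldOfOrder k p a).subtype.mapMatrix y = x := rfl
    have hy' : (fieldOfOrder k p a).subtype.mapMatrix y' = (x⁻¹ : GL (Fin d) k) := rfl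
    have hinj : Function.Injective
        ((fieldOfOrder k p a).subtype.mapMatrix (m := Fin d)) :=
      Matrix.map_injective Subtype.val_injective
    refine ⟨⟨y, y', hinj ?_, hinj ?_⟩, ?_⟩
    · rw [map_mul, hy, hy', map_one]; exact x.mul_inv
    · rw [map_mul, hy, hy', map_one]; exact x.inv_mul
    · ext i j; rfl

/-- If `S` is full and isomorphic to its Frobenius twist, then it is realised over the fixed
field of Frobenius. -/
theorem IsFullRepresentation.exists_conj_mem_generalLinearOfOrder {H k : Type*} [Group H] [Field k]
    [IsAlgClosed k] {p : ℕ} [Fact p.Prime] [CharP k p] {a d : ℕ} (ha : 0 < a)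
    {S : H →* GL (Fin d) k} (hS : IsFullRepresentation S) (T : GL (Fin d) k)
    (hT : ∀ h, T * S h * T⁻¹ = Matrix.GeneralLinearGroup.map (iterateFrobenius k p a) (S h)) :
    ∃ g : GL (Fin d) k, ∀ h : H, g * S h * g⁻¹ ∈ generalLinearOfOrder k p a d := by
  classical
  let F := iterateFrobenius k p a
  let φ : GL (Fin d) k →* GL (Fin d) k := Matrix.GeneralLinearGroup.map F
  -- The condition says that the columns of Q are fixed by v ↦ T⁻¹F(v), which is `ψ` below; then Q⁻¹
  -- S(h) Q is Frobenius-invariant.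
  suffices h : ∃ Q : GL (Fin d) k, φ Q = T * Q by
    obtain ⟨Q, hQ⟩ := h
    refine ⟨Q⁻¹, fun h => ?_⟩
    rw [mem_generalLinearOfOrder_iff]
    change φ _ = _
    have hT' : φ (S h) = T * S h * T⁻¹ := (hT h).symm
    rw [map_mul, map_mul, inv_inv, map_inv, hQ, hT']
    group
  have hFapply : ∀ x : k, F x = x ^ p ^ a := fun x => iterateFrobenius_def p a x
  rcases Nat.eq_zero_or_pos d with rfl | hd
  · exact ⟨1, Subsingleton.elim _ _⟩
  have hpq : 2 ≤ p ^ a := (Fact.out : p.Prime).two_le.trans (Nat.le_self_pow ha.ne' p)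
  let Ti : Matrix (Fin d) (Fin d) k := (T⁻¹ : GL (Fin d) k)
  have hTTi : (T : Matrix (Fin d) (Fin d) k) * Ti = 1 := T.mul_inv
  let ψ : (Fin d → k) →+ (Fin d → k) :=
    { toFun := fun v => Ti *ᵥ (F ∘ v)
      map_zero' := by
        have : F ∘ (0 : Fin d → k) = 0 := by ext; simp
        rw [this, mulVec_zero]
      map_add' := fun v w => by
        have : F ∘ (v + w) = F ∘ v + F ∘ w := by ext; simp
        rw [this, mulVec_add] }
  have hψ : ∀ v, ψ v = Ti *ᵥ (F ∘ v) := fun v => rfl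
  have hψT : ∀ v, (T : Matrix (Fin d) (Fin d) k) *ᵥ ψ v = F ∘ v := fun v => by
    rw [hψ, mulVec_mulVec, hTTi, one_mulVec]
  have hψsmul : ∀ (c : k) (v : Fin d → k), ψ (c • v) = c ^ p ^ a • ψ v := fun c v => by
    have : F ∘ (c • v) = c ^ p ^ a • (F ∘ v) := by ext; simp [← hFapply]
    rw [hψ, hψ, this, mulVec_smul]
  have hψinj : ∀ v : Fin d → k, ψ v = 0 → v = 0 := fun v hv => by
    have h1 := hψT v
    rw [hv, mulVec_zero] at h1
    ext i
    have h2 : F (v i) = 0 := (congrFun h1 i).symm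
    simpa using h2
  have hone : (fun _ => 1 : Fin d → k) ≠ 0 := fun h => one_ne_zero (congrFun h ⟨0, hd⟩)
  obtain ⟨w, hw0, hw⟩ := exists_ne_zero_fixed_of_powSemilinear hpq ψ hψsmul hψinj hone
  -- `ψ` commutes with each S(h) because T intertwines S with its twist, so one fixed vector yields
  -- a whole orbit of them.
  have hfix : ∀ h, ψ ((S h : Matrix (Fin d) (Fin d) k) *ᵥ w) =
      (S h : Matrix (Fin d) (Fin d) k) *ᵥ w := by
    intro h
    have h1 : F ∘ ((S h : Matrix (Fin d) (Fin d) k) *ᵥ w) =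
        (φ (S h) : Matrix (Fin d) (Fin d) k) *ᵥ (F ∘ w) := by
      ext i
      exact RingHom.map_mulVec F _ _ i
    have h2 : Ti * (φ (S h) : Matrix (Fin d) (Fin d) k) =
        (S h : Matrix (Fin d) (Fin d) k) * Ti := by
      have : T⁻¹ * φ (S h) = S h * T⁻¹ := by
        have hT' : φ (S h) = T * S h * T⁻¹ := (hT h).symm
        rw [hT']; group
      exact congrArg Units.val this
    rw [hψ, h1, mulVec_mulVec, h2, ← mulVec_mulVec, ← hψ, hw]
  have hspan : Submodule.span k (Set.range fun h => (S h : Matrix (Fin d) (Fin d) k) *ᵥ w) = ⊤ := by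
    obtain ⟨i, hi⟩ := Function.ne_iff.mp hw0
    rw [eq_top_iff]
    rintro v -
    let ev : Matrix (Fin d) (Fin d) k →ₗ[k] (Fin d → k) :=
      { toFun := fun A => A *ᵥ w
        map_add' := fun A B => add_mulVec A B w
        map_smul' := fun c A => smul_mulVec c A w }
    have hA : ev (vecMulVec v (Pi.single i (w i)⁻¹)) = v := by
      change vecMulVec v (Pi.single i (w i)⁻¹) *ᵥ w = v
      ext j
      simp only [mulVec, vecMulVec_apply, dotProduct, Pi.single_apply]
      rw [Finset.sum_eq_single i]
      · simp; rw [mul_assoc, inv_mul_cancel₀ hi, mul_one]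
      · intro b _ hb; simp [hb]
      · simp
    rw [← hA]
    have h1 : vecMulVec v (Pi.single i (w i)⁻¹) ∈
      Submodule.span k (Set.range fun h => (S h : Matrix (Fin d) (Fin d) k)) := by
      rw [show Submodule.span k (Set.range fun h => (S h : Matrix (Fin d) (Fin d) k)) = ⊤ from hS]
      trivial
    have h2 := Submodule.mem_map_of_mem (f := ev) h1
    rw [Submodule.map_span, ← Set.range_comp] at h2
    exact h2
  let b := Module.Basis.ofSpan hspan.ge
  have hbfix : ∀ i, ψ (b i) = b i := by
    intro i
    obtain ⟨h, hh⟩ := Module.Basis.ofSpan_subset hspan.ge ⟨i, rfl⟩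
    rw [← hh]; exact hfix h
  let e := b.indexEquiv (Pi.basisFun k (Fin d))
  let b' := b.reindex e
  have hb'fix : ∀ i, ψ (b' i) = b' i := fun i => by
    rw [Module.Basis.reindex_apply]; exact hbfix _
  let Q : Matrix (Fin d) (Fin d) k := (Pi.basisFun k (Fin d)).toMatrix b'
  let Q' : Matrix (Fin d) (Fin d) k := b'.toMatrix (Pi.basisFun k (Fin d))
  refine ⟨⟨Q, Q', Module.Basis.toMatrix_mul_toMatrix_flip _ _,
    Module.Basis.toMatrix_mul_toMatrix_flip _ _⟩, ?_⟩
  ext i j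
  have h1 := congrFun (hψT (b' j)) i
  rw [hb'fix] at h1
  exact h1.symm

/-- A matrix representation whose trace has nonzero pairing with that of a full one of the same
degree is conjugate to it. -/
theorem IsFullRepresentation.exists_conj_eq {H k : Type*} [Group H] [Fintype H] [Field k] {d : ℕ}
    {S : H →* GL (Fin d) k} (hS : IsFullRepresentation S) (R : H →* GL (Fin d) k)
    (hne : ∑ h, (R h : Matrix (Fin d) (Fin d) k).trace *
      (S h⁻¹ : Matrix (Fin d) (Fin d) k).trace ≠ 0) :
    ∃ g : GL (Fin d) k, ∀ h, g * S h * g⁻¹ = R h := by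
  classical
  obtain ⟨i, l, hil⟩ : ∃ i l, ∑ h, (R h : Matrix (Fin d) (Fin d) k) i i *
      (S h⁻¹ : Matrix (Fin d) (Fin d) k) l l ≠ 0 := by
    by_contra! hcon
    apply hne
    simp only [Matrix.trace, Matrix.diag_apply, Finset.sum_mul_sum]
    rw [Finset.sum_comm]
    refine Finset.sum_eq_zero fun i _ => ?_
    rw [Finset.sum_comm]
    exact Finset.sum_eq_zero fun l _ => hcon i l
  -- Averaging the elementary matrix E_il makes the (i, l) entry of T exactly the sum found nonzero
  -- above.
  let T : Matrix (Fin d) (Fin d) k :=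
    ∑ h, (R h : Matrix (Fin d) (Fin d) k) * single i l 1 * (S h⁻¹ : Matrix (Fin d) (Fin d) k)
  have hTil : T i l ≠ 0 := by
    simpa [T, Matrix.sum_apply, Matrix.mul_apply, Matrix.single_apply, Finset.sum_ite_eq,
      ite_and] using hil
  have hcomm : ∀ g, T * (S g : Matrix (Fin d) (Fin d) k) = (R g : Matrix (Fin d) (Fin d) k) * T := by
    intro g
    simp only [T, Finset.sum_mul, Finset.mul_sum]
    refine (Fintype.sum_equiv (Equiv.mulLeft g) _ _ fun h => ?_).symm
    have h1 : (S h⁻¹ : Matrix (Fin d) (Fin d) k) = (S (g * h)⁻¹ : Matrix (Fin d) (Fin d) k) *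
        (S g : Matrix (Fin d) (Fin d) k) := by
      rw [← Units.val_mul, ← map_mul]; congr 2; group
    have h2 : (R (g * h) : Matrix (Fin d) (Fin d) k) = (R g : Matrix (Fin d) (Fin d) k) *
        (R h : Matrix (Fin d) (Fin d) k) := by
      rw [← Units.val_mul, ← map_mul]
    simp only [Equiv.coe_mulLeft]
    rw [h1, h2]
    simp only [Matrix.mul_assoc]
  have hdet : T.det ≠ 0 := by
    intro h0
    obtain ⟨v, hv0, hv⟩ := Matrix.exists_mulVec_eq_zero_iff.mpr h0
    -- The kernel of T is stable under S, hence under all matrices; moving v to the basis vector e_l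
    -- then contradicts T_il ≠ 0.
    have key : ∀ A : Matrix (Fin d) (Fin d) k, T *ᵥ (A *ᵥ v) = 0 := by
      intro A
      have hA : A ∈ Submodule.span k (Set.range fun h => (S h : Matrix (Fin d) (Fin d) k)) := by
        rw [show Submodule.span k (Set.range fun h => (S h : Matrix (Fin d) (Fin d) k)) = ⊤ from hS]
        trivial
      induction hA using Submodule.span_induction with
      | mem A hA =>
        obtain ⟨g, rfl⟩ := hA
        simp only
        rw [mulVec_mulVec, hcomm, ← mulVec_mulVec, hv, mulVec_zero]
      | zero => simp
      | add A B _ _ hA hB => rw [add_mulVec, mulVec_add, hA, hB, add_zero]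
      | smul c A _ hA => rw [smul_mulVec, mulVec_smul, hA, smul_zero]
    obtain ⟨m, hm⟩ := Function.ne_iff.mp hv0
    have h1 := congrFun (key (single l m (v m)⁻¹)) i
    have h2 : single l m (v m)⁻¹ *ᵥ v = Pi.single l 1 := by
      ext j
      simp only [mulVec, dotProduct, single_apply, Pi.single_apply]
      rw [Finset.sum_eq_single m]
      · by_cases hj : l = j
        · subst hj; simp; exact inv_mul_cancel₀ hm
        · simp [hj, Ne.symm hj]
      · intro b _ hb; simp [hb.symm]
      · simp
    rw [h2] at h1
    simp at h1
    exact hTil h1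
  let g : GL (Fin d) k := Matrix.GeneralLinearGroup.mkOfDetNeZero T hdet
  refine ⟨g, fun h => ?_⟩
  have h1 : g * S h = R h * g := Units.ext (hcomm h)
  rw [h1, mul_inv_cancel_right]

/-! ### Schur's lemma and orthogonality -/

/-- A linear endomorphism commuting with an irreducible representation is scalar. -/
theorem Representation.IsIrreducible.exists_eq_smul_id {H K V : Type*} [Group H] [Field K]
    [IsAlgClosed K] [AddCommGroup V] [Module K V] [FiniteDimensional K V]
    {σ : Representation K H V} (hσ : σ.IsIrreducible) (f : V →ₗ[K] V)
    (hf : ∀ h, f ∘ₗ σ h = σ h ∘ₗ f) : ∃ c : K, f = c • LinearMap.id := by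
  obtain ⟨c, hc⟩ := (Representation.IsIrreducible.algebraMap_intertwiningMap_bijective_of_isAlgClosed
    (ρ := σ)).2 ⟨f, hf⟩
  refine ⟨c, ?_⟩
  ext v
  have := congrArg (fun F : Representation.IntertwiningMap σ σ => F v) hc
  exact this.symm

/-- Schur orthogonality for matrix coefficients, for a matrix representation whose commutant
consists of scalars. -/
theorem card_smul_eq_sum_trace_smul {H K : Type*} [Group H] [Fintype H] [Field K] {d : ℕ}
    (S : H →* Matrix (Fin d) (Fin d) K)
    (hS : ∀ X, (∀ h, X * S h = S h * X) → ∃ c : K, X = c • (1 : Matrix (Fin d) (Fin d) K))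
    (E : Matrix (Fin d) (Fin d) K) :
    (Fintype.card H : K) • E = (d : K) • ∑ h, (S h⁻¹ * E).trace • S h := by
  classical
  -- The average of X is a scalar matrix, identified by its trace. Multiplying by d instead of
  -- dividing keeps the identity valid over subrings and after reduction.
  have havg : ∀ X : Matrix (Fin d) (Fin d) K, (d : K) • ∑ h, S h * X * S h⁻¹ =
      ((Fintype.card H : K) * X.trace) • (1 : Matrix (Fin d) (Fin d) K) := by
    intro X
    obtain ⟨c, hc⟩ := hS (∑ h, S h * X * S h⁻¹) (by
      intro g
      simp only [Finset.sum_mul, Finset.mul_sum]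
      refine (Fintype.sum_equiv (Equiv.mulLeft g) _ _ fun h => ?_).symm
      simp only [Equiv.coe_mulLeft]
      have h1 : S h⁻¹ = S (g * h)⁻¹ * S g := by
        rw [← map_mul]; congr 1; group
      rw [h1, map_mul]
      simp only [Matrix.mul_assoc])
    have ht := congrArg Matrix.trace hc
    rw [Matrix.trace_sum] at ht
    have h2 : ∀ h, (S h * X * S h⁻¹).trace = X.trace := by
      intro h
      rw [Matrix.mul_assoc, Matrix.trace_mul_comm, Matrix.mul_assoc, ← map_mul, inv_mul_cancel,
        map_one, Matrix.mul_one]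
    simp only [h2, Finset.sum_const, Finset.card_univ, nsmul_eq_mul, Matrix.trace_smul,
      Matrix.trace_one, Fintype.card_fin, smul_eq_mul] at ht
    rw [hc, smul_smul, ht, mul_comm]
  have hent : ∀ i j m l, (d : K) * ∑ h, S h i j * S h⁻¹ m l =
      if i = l ∧ j = m then (Fintype.card H : K) else 0 := by
    intro i j m l
    have h1 := congrFun (congrFun (havg (single j m 1)) i) l
    simp only [Matrix.smul_apply, Matrix.sum_apply, smul_eq_mul, Matrix.one_apply] at h1
    have h2 : ∀ h, (S h * single j m (1 : K) * S h⁻¹ : Matrix (Fin d) (Fin d) K) i l = S h i j * S h⁻¹ m l := by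
      intro h
      simp [Matrix.mul_apply, Matrix.single_apply, ite_and]
    simp only [h2] at h1
    rw [h1]
    by_cases hjm : j = m
    · subst hjm; simp
    · rw [Matrix.trace_single_eq_of_ne _ _ _ hjm]; simp [hjm]
  ext i j
  have h3 : ((d : K) • ∑ h, (S h⁻¹ * E).trace • S h) i j =
      ∑ m, ∑ l, E l m * ((d : K) * ∑ h, S h i j * S h⁻¹ m l) := by
    simp only [Matrix.smul_apply, Matrix.sum_apply, smul_eq_mul, Matrix.trace, Matrix.diag_apply,
      Matrix.mul_apply, Finset.mul_sum, Finset.sum_mul]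
    rw [Finset.sum_comm]
    refine Finset.sum_congr rfl fun m _ => ?_
    rw [Finset.sum_comm]
    refine Finset.sum_congr rfl fun l _ => Finset.sum_congr rfl fun h _ => by ring
  rw [h3]
  simp only [hent]
  rw [Finset.sum_eq_single j, Finset.sum_eq_single i]
  · simp [mul_comm]
  · intro l _ hl; simp [hl.symm]
  · simp
  · intro m _ hm; simp [hm.symm]
  · simp

theorem sum_trace_mul_trace_inv {H K : Type*} [Group H] [Fintype H] [Field K] [CharZero K] {d : ℕ}
    (hd : d ≠ 0) (S : H →* Matrix (Fin d) (Fin d) K)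
    (hS : ∀ X, (∀ h, X * S h = S h * X) → ∃ c : K, X = c • (1 : Matrix (Fin d) (Fin d) K)) :
    ∑ h, (S h).trace * (S h⁻¹).trace = Fintype.card H := by
  have h := congrArg Matrix.trace (card_smul_eq_sum_trace_smul S hS 1)
  simp only [Matrix.trace_smul, Matrix.trace_one, Matrix.trace_sum, Matrix.mul_one, smul_eq_mul,
    Fintype.card_fin] at h
  rw [mul_comm] at h
  rw [mul_left_cancel₀ (Nat.cast_ne_zero.mpr hd) h]
  exact Finset.sum_congr rfl fun _ _ => mul_comm _ _

/-! ### Reduction modulo p -/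

/-- A representation of a finite group over a field can be written in a basis with all matrix
coefficients in a given valuation subring. -/
theorem exists_basis_toMatrix_mem_valuationSubring {H K : Type*} [Group H] [Finite H] [Field K]
    {d : ℕ} (O : ValuationSubring K) (σ : Representation K H (Fin d → K)) :
    ∃ b : Module.Basis (Fin d) K (Fin d → K), ∀ h i j, LinearMap.toMatrix b b (σ h) i j ∈ O := by
  classical
  -- L is an H-stable lattice: the O-span of the translates of the standard basis. A finitely
  -- generated torsion-free module over a valuation ring is free, and an O-basis of L is the desired
  -- basis.
  let L : Submodule O (Fin d → K) :=
    Submodule.span O (Set.range fun x : H × Fin d => σ x.1 (Pi.single x.2 1))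
  have hmem : ∀ (h : H) (i : Fin d), σ h (Pi.single i 1) ∈ L :=
    fun h i => Submodule.subset_span ⟨(h, i), rfl⟩
  have hstable : ∀ (h : H) v, v ∈ L → σ h v ∈ L := by
    intro h v hv
    induction hv using Submodule.span_induction with
    | mem v hv =>
      obtain ⟨⟨g, i⟩, rfl⟩ := hv
      have : σ h (σ g (Pi.single i 1)) = σ (h * g) (Pi.single i 1) := by
        rw [map_mul]; rfl
      simp only [this]
      exact hmem _ _
    | zero => simp
    | add v w _ _ hv hw => rw [map_add]; exact add_mem hv hw
    | smul c v _ hv =>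
      have : σ h (c • v) = c • σ h v := (σ h).map_smul (c : K) v
      rw [this]; exact Submodule.smul_mem _ _ hv
  have hlat : Submodule.IsLattice K L := by
    refine ⟨Submodule.fg_span (Set.finite_range _), ?_⟩
    rw [eq_top_iff, ← (Pi.basisFun K (Fin d)).span_eq, Submodule.span_le]
    rintro _ ⟨i, rfl⟩
    apply Submodule.subset_span
    simpa using hmem 1 i
  have hfin : Module.Finite O L := Submodule.IsLattice.finite K L
  have htf : Module.IsTorsionFree O (Fin d → K) := Module.IsTorsionFree.trans_faithfulSMul O K _
  have hflat : Module.Flat O L := by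
    rw [Module.Flat.flat_iff_torsion_eq_bot_of_isBezout, ← Submodule.isTorsionFree_iff_torsion_eq_bot]
    infer_instance
  have hfree : Module.Free O L := Module.free_of_flat_of_isLocalRing
  let b₀ := Module.Free.chooseBasis O L
  let b₁ := b₀.extendOfIsLattice K
  let e := b₁.indexEquiv (Pi.basisFun K (Fin d))
  have hb₁ : ∀ i, b₁ i = b₀ i := fun i => Module.Basis.extendOfIsLattice_apply K b₀ i
  have hrepr : ∀ (v : L) i, b₁.repr v i ∈ O := by
    intro v i
    have hv : (v : Fin d → K) = ∑ j, ((b₀.repr v j : O) : K) • b₁ j := by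
      conv_lhs => rw [← b₀.sum_repr v]
      rw [Submodule.coe_sum]
      exact Finset.sum_congr rfl fun j _ => by rw [hb₁]; rfl
    rw [hv, b₁.repr_sum_self]
    exact (b₀.repr v i).2
  refine ⟨b₁.reindex e, fun h i j => ?_⟩
  rw [LinearMap.toMatrix_apply, Module.Basis.repr_reindex_apply, Module.Basis.reindex_apply, hb₁]
  exact hrepr ⟨_, hstable h _ (b₀ _).2⟩ _

/-- A homomorphism from a field to an algebraically closed field extends to any extension field that
is finitely generated as a ring. -/
theorem exists_ringHom_comp_eq_of_finiteType {F E k : Type*} [Field F] [Field E] [Field k]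
    [IsAlgClosed k] (hE : Algebra.FiniteType ℤ E) (i : F →+* E) (g : F →+* k) :
    ∃ l : E →+* k, l.comp i = g := by
  let _ := i.toAlgebra
  let _ := g.toAlgebra
  have : IsScalarTower ℤ F E := IsScalarTower.of_algebraMap_eq' (RingHom.ext_int _ _)
  have hft' : Algebra.FiniteType F E := Algebra.FiniteType.of_restrictScalars_finiteType ℤ F E
  -- Zariski's lemma: a field finitely generated as a ring over F is finite over F, so it embeds in
  -- k over F.
  have hfin : Module.Finite F E := finite_of_finite_type_of_isJacobsonRing F E
  let l : E →ₐ[F] k := IsAlgClosed.lift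
  exact ⟨l.toRingHom, l.comp_algebraMap⟩

/-- A homomorphism from an integral subring of `K` to an algebraically closed field of prime
characteristic extends to all finitely generated subrings of some valuation subring. -/
theorem exists_valuationSubring_extend_ringHom {K k : Type*} [Field K] [CharZero K] [Field k]
    [IsAlgClosed k] {p : ℕ} [Fact p.Prime] [CharP k p] (B : Subalgebra ℤ K)
    [Algebra.IsIntegral ℤ B] (hB : B.FG) (g : B →+* k) :
    ∃ O : ValuationSubring K, ∀ s : Set K, s.Finite → s ⊆ O →
      ∃ (A : Subalgebra ℤ K) (hBA : B ≤ A) (f : A →+* k), s ⊆ A ∧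
        ∀ b : B, f (Subalgebra.inclusion hBA b) = g b := by
  let P : Ideal B.toSubring := RingHom.ker g
  have hP : P ≠ ⊤ := RingHom.ker_ne_top g
  -- O contains B, and ker g lies in its maximal ideal. The residue field of O may be too large to
  -- map to k, which is why only finitely generated subrings A are reduced.
  obtain ⟨O, hBO, hPO⟩ := P.image_subset_nonunits_valuationSubring hP
  refine ⟨O, fun s hs hsO => ?_⟩
  obtain ⟨t, ht⟩ := hB
  let A : Subalgebra ℤ K := Algebra.adjoin ℤ (↑t ∪ s)
  have hBA : B ≤ A := by rw [← ht]; exact Algebra.adjoin_mono Set.subset_union_left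
  have hAO : ∀ x ∈ A, x ∈ O := by
    intro x hx
    have : A ≤ subalgebraOfSubring O.toSubring := by
      refine Algebra.adjoin_le (Set.union_subset (fun y hy => ?_) hsO)
      exact hBO (show y ∈ B from ht ▸ Algebra.subset_adjoin hy)
    exact this hx
  have hAft : Algebra.FiniteType ℤ A := by
    rw [← Subalgebra.fg_iff_finiteType]
    exact Subalgebra.fg_def.mpr ⟨_, t.finite_toSet.union hs, rfl⟩
  let i : B →+* A := (Subalgebra.inclusion hBA).toRingHom
  let j : A →+* O :=
    { toFun := fun x => ⟨x, hAO x x.2⟩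
      map_one' := rfl
      map_mul' := fun _ _ => rfl
      map_zero' := rfl
      map_add' := fun _ _ => rfl }
  obtain ⟨M, hM, hjM⟩ := Ideal.exists_le_maximal ((IsLocalRing.maximalIdeal O).comap j)
    (Ideal.comap_ne_top j (Ideal.IsPrime.ne_top'))
  let Q : Ideal B := RingHom.ker g
  have hQM : Q ≤ M.comap i := by
    intro b hb
    apply hjM
    have h1 : (b : K) ∈ O.nonunits := hPO ⟨b, hb, rfl⟩
    rw [Ideal.mem_comap, IsLocalRing.mem_maximalIdeal]
    exact (ValuationSubring.coe_mem_nonunits_iff (A := O) (a := j (i b))).mp h1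
  -- The kernel of g contains p, so it contracts to a maximal ideal of ℤ; integrality of B makes it
  -- maximal. Hence A/M is a field extension of the field B/Q.
  have hQmax : Q.IsMaximal := by
    have hQprime : Q.IsPrime := RingHom.ker_isPrime g
    have : (Q.comap (algebraMap ℤ B)).IsMaximal := by
      refine Ideal.IsPrime.isMaximal inferInstance fun h0 => ?_
      have hp : (p : ℤ) ∈ Q.comap (algebraMap ℤ B) := by
        rw [Ideal.mem_comap, RingHom.mem_ker]
        simp
      rw [h0, Ideal.mem_bot] at hp
      exact (Fact.out : p.Prime).ne_zero (by exact_mod_cast hp)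
    exact Ideal.isMaximal_of_isIntegral_of_isMaximal_comap Q this
  let _ : Field (B ⧸ Q) := Ideal.Quotient.field Q
  let _ : Field (A ⧸ M) := Ideal.Quotient.field M
  have hft : Algebra.FiniteType ℤ (A ⧸ M) :=
    hAft.of_surjective (Ideal.Quotient.mkₐ ℤ M) (Ideal.Quotient.mkₐ_surjective ℤ M)
  obtain ⟨l, hl⟩ := exists_ringHom_comp_eq_of_finiteType hft (Ideal.quotientMap M i hQM)
    (Ideal.Quotient.lift Q g fun _ h => h)
  refine ⟨A, hBA, l.comp (Ideal.Quotient.mk M),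
    fun x hx => Algebra.subset_adjoin (Or.inr hx), fun b => ?_⟩
  exact congrArg (fun u : B ⧸ Q →+* k => u (Ideal.Quotient.mk Q b)) hl

theorem exists_isPrimitiveRoot_of_not_dvd {k : Type*} [Field k] [IsAlgClosed k] {p : ℕ}
    [Fact p.Prime] [CharP k p] {N : ℕ} (hp : ¬ p ∣ N) : ∃ u : k, IsPrimitiveRoot u N := by
  have : NeZero N := ⟨by rintro rfl; simp at hp⟩
  have : NeZero (N : k) := ⟨fun h => hp ((CharP.cast_eq_zero_iff k p N).mp h)⟩
  obtain ⟨u, hu⟩ := IsAlgClosed.exists_root (Polynomial.cyclotomic N k)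
    (Polynomial.degree_cyclotomic_pos N k (NeZero.pos N)).ne'
  exact ⟨u, Polynomial.isRoot_cyclotomic_iff.mp hu⟩

/-- Over the ring `ℤ[ζ]` generated by the roots of unity of order dividing `N`, an identification of
roots of unity is inverted by a ring homomorphism. -/
theorem exists_ringHom_adjoin_rootsOfUnity {k K : Type*} [Field k] [IsAlgClosed k] {p : ℕ}
    [Fact p.Prime] [CharP k p] [Field K] [CharZero K] {N : ℕ} (hp : ¬ p ∣ N)
    (φ : rootsOfUnity N k →* Kˣ) (hφ : Function.Injective φ) :
    ∃ (B : Subalgebra ℤ K) (_ : Algebra.IsIntegral ℤ B) (_ : B.FG) (g : B →+* k),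
      ∀ u : rootsOfUnity N k, ∃ hu : (φ u : K) ∈ B, g ⟨φ u, hu⟩ = ((u : kˣ) : k) := by
  have hN : N ≠ 0 := by rintro rfl; simp at hp
  have : NeZero N := ⟨hN⟩
  have : NeZero (N : k) := ⟨fun h => hp ((CharP.cast_eq_zero_iff k p N).mp h)⟩
  obtain ⟨u₀, hu₀⟩ := exists_isPrimitiveRoot_of_not_dvd (k := k) hp
  let w : rootsOfUnity N k := hu₀.toRootsOfUnity
  have hw : (((w : rootsOfUnity N k) : kˣ) : k) = u₀ := rfl
  have hwprim : IsPrimitiveRoot w N := by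
    rw [← IsPrimitiveRoot.coe_submonoidClass_iff, ← IsPrimitiveRoot.coe_units_iff]
    exact hu₀
  let ζ : K := φ w
  have hζ : IsPrimitiveRoot ζ N :=
    IsPrimitiveRoot.coe_units_iff.mpr (hwprim.map_of_injective hφ)
  have hζint : IsIntegral ℤ ζ := hζ.isIntegral (Nat.pos_of_ne_zero hN)
  -- ℤ[ζ] is ℤ[X]/(Φ_N), and u₀ is a root of Φ_N in k, so ζ ↦ u₀ defines the map.
  let pb := Algebra.adjoin.powerBasis' hζint
  have hgen : pb.gen = ⟨ζ, Algebra.self_mem_adjoin_singleton ℤ ζ⟩ :=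
    Algebra.adjoin.powerBasis'_gen hζint
  have hroot : Polynomial.aeval u₀ (minpoly ℤ pb.gen) = 0 := by
    have h1 : minpoly ℤ pb.gen = minpoly ℤ ζ := by
      rw [hgen]
      exact (minpoly.algHom_eq (Algebra.adjoin ℤ {ζ}).val Subtype.val_injective _).symm
    rw [h1, ← Polynomial.cyclotomic_eq_minpoly hζ (Nat.pos_of_ne_zero hN)]
    have h2 := hu₀.isRoot_cyclotomic (Nat.pos_of_ne_zero hN)
    rw [Polynomial.IsRoot, ← Polynomial.map_cyclotomic_int, Polynomial.eval_map] at h2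
    exact h2
  let g : Algebra.adjoin ℤ {ζ} →ₐ[ℤ] k := pb.lift u₀ hroot
  have hg : g ⟨ζ, Algebra.self_mem_adjoin_singleton ℤ ζ⟩ = u₀ := by
    rw [← hgen]; exact pb.lift_gen u₀ hroot
  refine ⟨Algebra.adjoin ℤ {ζ}, Algebra.IsIntegral.adjoin (by simpa using hζint),
    Subalgebra.fg_def.mpr ⟨_, Set.finite_singleton _, rfl⟩, g.toRingHom, fun u => ?_⟩
  obtain ⟨m, hm⟩ : ∃ m : ℕ, w ^ m = u := by
    obtain ⟨m, -, hm⟩ := hu₀.eq_pow_of_pow_eq_one (ξ := ((u : kˣ) : k))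
      (congrArg Units.val ((mem_rootsOfUnity N _).mp u.2))
    exact ⟨m, Subtype.ext (Units.ext hm)⟩
  have h1 : (φ u : K) = ζ ^ m := by rw [← hm, map_pow]; rfl
  refine ⟨h1 ▸ pow_mem (Algebra.self_mem_adjoin_singleton ℤ ζ) m, ?_⟩
  have h2 : (⟨φ u, h1 ▸ pow_mem (Algebra.self_mem_adjoin_singleton ℤ ζ) m⟩ :
      Algebra.adjoin ℤ {ζ}) = ⟨ζ, Algebra.self_mem_adjoin_singleton ℤ ζ⟩ ^ m := Subtype.ext h1
  change g _ = _
  rw [h2, map_pow, hg, ← hm, ← hw]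
  simp

/-- A representation over a field of characteristic zero can be reduced modulo a prime compatibly
with a given identification of roots of unity. -/
theorem exists_reduction {H K k : Type*} [Group H] [Finite H] [Field K] [CharZero K] [Field k]
    [IsAlgClosed k] {p : ℕ} [Fact p.Prime] [CharP k p] {N d : ℕ} (hp : ¬ p ∣ N)
    (φ : rootsOfUnity N k →* Kˣ) (hφ : Function.Injective φ)
    (σ : Representation K H (Fin d → K)) :
    ∃ (b : Module.Basis (Fin d) K (Fin d → K)) (A : Subalgebra ℤ K) (f : A →+* k)
      (S : H →* Matrix (Fin d) (Fin d) A),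
      (∀ h, (S h).map Subtype.val = LinearMap.toMatrix b b (σ h)) ∧
      ∀ u : rootsOfUnity N k, ∃ hu : (φ u : K) ∈ A, f ⟨φ u, hu⟩ = ((u : kˣ) : k) := by
  obtain ⟨B, hBint, hBfg, g, hg⟩ := exists_ringHom_adjoin_rootsOfUnity hp φ hφ
  obtain ⟨O, hO⟩ := exists_valuationSubring_extend_ringHom B hBfg g
  obtain ⟨b, hb⟩ := exists_basis_toMatrix_mem_valuationSubring O σ
  obtain ⟨A, hBA, f, hsA, hf⟩ := hO
    (Set.range fun x : H × Fin d × Fin d => LinearMap.toMatrix b b (σ x.1) x.2.1 x.2.2)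
    (Set.finite_range _) (by rintro _ ⟨x, rfl⟩; exact hb _ _ _)
  have hA : ∀ h i j, LinearMap.toMatrix b b (σ h) i j ∈ A := fun h i j => hsA ⟨(h, i, j), rfl⟩
  let S₀ : H → Matrix (Fin d) (Fin d) A := fun h => Matrix.of fun i j => ⟨_, hA h i j⟩
  have hS₀ : ∀ h, A.subtype.mapMatrix (S₀ h) = LinearMap.toMatrix b b (σ h) := fun h => rfl
  have hinj : Function.Injective (A.subtype.mapMatrix (m := Fin d)) :=
    Matrix.map_injective Subtype.val_injective
  refine ⟨b, A, f, { toFun := S₀, map_one' := hinj ?_, map_mul' := fun x y => hinj ?_ },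
    fun h => rfl, fun u => ?_⟩
  · rw [hS₀, map_one, LinearMap.toMatrix_one, map_one]
  · rw [map_mul, hS₀, hS₀, hS₀, map_mul]; exact LinearMap.toMatrix_mul b _ _
  · obtain ⟨hu, hgu⟩ := hg u
    exact ⟨hBA hu, (hf ⟨_, hu⟩).trans hgu⟩

/-! ### Galois theory of cyclotomic subfields of ℂ -/

theorem cyclotomicSubfield_mono {n M : ℕ} (hM : M ≠ 0) (h : n ∣ M) :
    cyclotomicSubfield n ≤ cyclotomicSubfield M := by
  obtain ⟨c, rfl⟩ := h
  have hn : (n : ℂ) ≠ 0 := Nat.cast_ne_zero.mpr (left_ne_zero_of_mul hM)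
  have hc : (c : ℂ) ≠ 0 := Nat.cast_ne_zero.mpr (right_ne_zero_of_mul hM)
  refine IntermediateField.adjoin_le_iff.mpr (Set.singleton_subset_iff.mpr ?_)
  have : Complex.exp (2 * Real.pi * Complex.I / n) =
      Complex.exp (2 * Real.pi * Complex.I / (n * c : ℕ)) ^ c := by
    rw [← Complex.exp_nat_mul]
    congr 1
    push_cast
    field_simp
  rw [this]
  exact pow_mem (IntermediateField.mem_adjoin_simple_self ℚ _) c

theorem mem_cyclotomicSubfield_of_pow_eq_one {M : ℕ} [NeZero M] {z : ℂ} (hz : z ^ M = 1) :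
    z ∈ cyclotomicSubfield M := by
  obtain ⟨i, -, rfl⟩ := (Complex.isPrimitiveRoot_exp M (NeZero.ne M)).eq_pow_of_pow_eq_one hz
  exact pow_mem (IntermediateField.mem_adjoin_simple_self ℚ _) i

instance isCyclotomicExtension_cyclotomicSubfield (M : ℕ) [NeZero M] :
    IsCyclotomicExtension {M} ℚ (cyclotomicSubfield M) := by
  have hζ := Complex.isPrimitiveRoot_exp M (NeZero.ne M)
  change IsCyclotomicExtension {M} ℚ (cyclotomicSubfield M).toSubalgebra
  rw [cyclotomicSubfield, IntermediateField.adjoin_simple_toSubalgebra_of_isAlgebraic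
    (hζ.isIntegral (NeZero.pos M)).tower_top.isAlgebraic]
  exact hζ.adjoin_isCyclotomicExtension ℚ

instance numberField_cyclotomicSubfield (M : ℕ) [NeZero M] : NumberField (cyclotomicSubfield M) :=
  IsCyclotomicExtension.numberField {M} ℚ _

instance isGalois_cyclotomicSubfield (M : ℕ) [NeZero M] : IsGalois ℚ (cyclotomicSubfield M) :=
  IsCyclotomicExtension.isGalois {M} ℚ _

/-- The automorphism of `ℚ(ζ_M)` raising the `M`-th roots of unity to the power `t`. -/
def cyclotomicAut (M : ℕ) [NeZero M] (t : ℕ) (ht : t.Coprime M) : Gal(cyclotomicSubfield M/ℚ) :=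
  (IsCyclotomicExtension.Rat.galEquivZMod M (cyclotomicSubfield M)).symm (ZMod.unitOfCoprime t ht)

theorem cyclotomicAut_apply {M : ℕ} [NeZero M] {t : ℕ} (ht : t.Coprime M)
    {z : cyclotomicSubfield M} (hz : z ^ M = 1) : cyclotomicAut M t ht z = z ^ t := by
  rw [IsCyclotomicExtension.Rat.galEquivZMod_apply_of_pow_eq M _ _ hz, cyclotomicAut,
    MulEquiv.apply_symm_apply, ZMod.coe_unitOfCoprime, ZMod.val_natCast,
    ← pow_mod_orderOf z (t % M), Nat.mod_mod_of_dvd _ (orderOf_dvd_of_pow_eq_one hz),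
    pow_mod_orderOf]

theorem exists_eq_cyclotomicAut {M : ℕ} [NeZero M] (τ : Gal(cyclotomicSubfield M/ℚ)) :
    ∃ (t : ℕ) (ht : t.Coprime M), τ = cyclotomicAut M t ht := by
  let u := IsCyclotomicExtension.Rat.galEquivZMod M (cyclotomicSubfield M) τ
  refine ⟨(u : ZMod M).val, ZMod.val_coe_unit_coprime u, ?_⟩
  rw [cyclotomicAut, MulEquiv.eq_symm_apply]
  ext
  simp [u]

theorem cyclotomicAut_congr {M : ℕ} [NeZero M] {s t : ℕ} (hs : s.Coprime M) (ht : t.Coprime M)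
    (h : s ≡ t [MOD M]) : cyclotomicAut M s hs = cyclotomicAut M t ht := by
  rw [cyclotomicAut, cyclotomicAut]
  congr 1
  ext
  simpa using (ZMod.natCast_eq_natCast_iff _ _ _).mpr h

theorem cyclotomicAut_mul {M : ℕ} [NeZero M] {s t : ℕ} (hs : s.Coprime M) (ht : t.Coprime M) :
    cyclotomicAut M (s * t) (hs.mul_left ht) = cyclotomicAut M s hs * cyclotomicAut M t ht := by
  rw [cyclotomicAut, cyclotomicAut, cyclotomicAut, ← map_mul]
  congr 1
  ext
  simp

/-- An element of `ℚ(ζ_M)` lies in `ℚ(ζ_n)`, with `n ∣ M`, if and only if it is fixed by the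
automorphisms `ζ_M ↦ ζ_M ^ t` with `t ≡ 1` modulo `n`. -/
theorem mem_cyclotomicSubfield_iff_fixed {n M : ℕ} [NeZero M] (h : n ∣ M)
    (x : cyclotomicSubfield M) : (x : ℂ) ∈ cyclotomicSubfield n ↔
      ∀ (t : ℕ) (ht : t.Coprime M), t ≡ 1 [MOD n] → cyclotomicAut M t ht x = x := by
  have hn : n ≠ 0 := by rintro rfl; exact NeZero.ne M (zero_dvd_iff.mp h)
  have hle := cyclotomicSubfield_mono (NeZero.ne M) h
  have hprim := Complex.isPrimitiveRoot_exp n hn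
  let z : cyclotomicSubfield M := ⟨_, hle (IntermediateField.mem_adjoin_simple_self ℚ
    (Complex.exp (2 * Real.pi * Complex.I / n)))⟩
  have hz : IsPrimitiveRoot z n := by
    refine IsPrimitiveRoot.of_map_of_injective (f := (cyclotomicSubfield M).val) hprim
      (RingHom.injective _)
  have hzM : z ^ M = 1 := (hz.pow_eq_one_iff_dvd M).mpr h
  constructor
  · intro hx t ht htn
    have key : ∀ (y : ℂ), y ∈ cyclotomicSubfield n →
        ∃ hy : y ∈ cyclotomicSubfield M, cyclotomicAut M t ht ⟨y, hy⟩ = ⟨y, hy⟩ := by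
      intro y hy
      induction hy using IntermediateField.adjoin_induction with
      | mem y hy =>
        rw [Set.mem_singleton_iff] at hy
        subst hy
        refine ⟨z.2, ?_⟩
        change cyclotomicAut M t ht z = z
        rw [cyclotomicAut_apply ht hzM]
        conv_rhs => rw [← pow_one z]
        rwa [(hz.isOfFinOrder hn).pow_inj_mod, ← hz.eq_orderOf]
      | algebraMap q =>
        exact ⟨(cyclotomicSubfield M).algebraMap_mem q, (cyclotomicAut M t ht).commutes q⟩
      | add a b _ _ ha hb =>
        obtain ⟨ha, ha'⟩ := ha
        obtain ⟨hb, hb'⟩ := hb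
        refine ⟨add_mem ha hb, ?_⟩
        have := map_add (cyclotomicAut M t ht) ⟨a, ha⟩ ⟨b, hb⟩
        rw [ha', hb'] at this
        exact this
      | mul a b _ _ ha hb =>
        obtain ⟨ha, ha'⟩ := ha
        obtain ⟨hb, hb'⟩ := hb
        refine ⟨mul_mem ha hb, ?_⟩
        have := map_mul (cyclotomicAut M t ht) ⟨a, ha⟩ ⟨b, hb⟩
        rw [ha', hb'] at this
        exact this
      | inv a _ ha =>
        obtain ⟨ha, ha'⟩ := ha
        refine ⟨inv_mem ha, ?_⟩
        have := map_inv₀ (cyclotomicAut M t ht) ⟨a, ha⟩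
        rw [ha'] at this
        exact this
    exact (key x hx).2
  · intro hfix
    have hmem : x ∈ IntermediateField.adjoin ℚ {z} := by
      rw [← IsGalois.fixedField_fixingSubgroup (IntermediateField.adjoin ℚ {z}),
        IntermediateField.mem_fixedField_iff]
      intro τ hτ
      obtain ⟨t, ht, rfl⟩ := exists_eq_cyclotomicAut τ
      apply hfix
      have h1 : cyclotomicAut M t ht z = z :=
        (IntermediateField.mem_fixingSubgroup_iff _ _).mp hτ z
          (IntermediateField.mem_adjoin_simple_self ℚ z)
      rw [cyclotomicAut_apply ht hzM] at h1
      conv_rhs at h1 => rw [← pow_one z]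
      rwa [(hz.isOfFinOrder hn).pow_inj_mod, ← hz.eq_orderOf] at h1
    clear hfix
    induction hmem using IntermediateField.adjoin_induction with
    | mem y hy =>
      rw [Set.mem_singleton_iff.mp hy]
      exact IntermediateField.mem_adjoin_simple_self ℚ _
    | algebraMap q => simp
    | add a b _ _ ha hb => exact add_mem ha hb
    | mul a b _ _ ha hb => exact mul_mem ha hb
    | inv a _ ha => exact inv_mem ha

/-- Any t ≡ 1 mod gcd(m, n) is, modulo lcm(m, n), a product rs with r ≡ 1 mod m and s ≡ 1 mod n, by
the Chinese remainder theorem. The automorphisms of r and s each fix x, hence so does that of t. -/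
theorem mem_cyclotomicSubfield_gcd {m n : ℕ} (hm : m ≠ 0) (hn : n ≠ 0) {x : ℂ}
    (hxm : x ∈ cyclotomicSubfield m) (hxn : x ∈ cyclotomicSubfield n) :
    x ∈ cyclotomicSubfield (m.gcd n) := by
  have : NeZero (m.lcm n) := ⟨Nat.lcm_ne_zero hm hn⟩
  have hxM := cyclotomicSubfield_mono (NeZero.ne _) (Nat.dvd_lcm_left m n) hxm
  have hm' := (mem_cyclotomicSubfield_iff_fixed (Nat.dvd_lcm_left m n) ⟨x, hxM⟩).mp hxm
  have hn' := (mem_cyclotomicSubfield_iff_fixed (Nat.dvd_lcm_right m n) ⟨x, hxM⟩).mp hxn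
  refine (mem_cyclotomicSubfield_iff_fixed
    ((Nat.gcd_dvd_left m n).trans (Nat.dvd_lcm_left m n)) ⟨x, hxM⟩).mpr fun t ht htg => ?_
  obtain ⟨r, hrm, hrn⟩ := Nat.chineseRemainder' htg.symm
  obtain ⟨s, hsm, hsn⟩ := Nat.chineseRemainder' htg
  have hcop : ∀ u : ℕ, u.Coprime m → u.Coprime n → u.Coprime (m.lcm n) := fun u h1 h2 =>
    (h1.mul_right h2).coprime_dvd_right (Nat.lcm_dvd_mul m n)
  have htm : t.Coprime m := ht.coprime_dvd_right (Nat.dvd_lcm_left m n)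
  have htn : t.Coprime n := ht.coprime_dvd_right (Nat.dvd_lcm_right m n)
  have hr : r.Coprime (m.lcm n) := hcop r (by rw [Nat.Coprime, hrm.gcd_eq]; simp)
    (by rw [Nat.Coprime, hrn.gcd_eq]; exact htn)
  have hs : s.Coprime (m.lcm n) := hcop s (by rw [Nat.Coprime, hsm.gcd_eq]; exact htm)
    (by rw [Nat.Coprime, hsn.gcd_eq]; simp)
  have h1 : r * s ≡ t [MOD m] := by simpa using hrm.mul hsm
  have h2 : r * s ≡ t [MOD n] := by simpa using hrn.mul hsn
  have h3 : r * s ≡ t [MOD m.lcm n] := Nat.modEq_iff_dvd.mpr (by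
    rw [Nat.modEq_iff_dvd] at h1 h2
    have := Int.coe_lcm_dvd h1 h2
    simpa using this)
  rw [← cyclotomicAut_congr (hr.mul_left hs) ht h3, cyclotomicAut_mul hr hs, AlgEquiv.mul_apply,
    hn' s hs hsn, hm' r hr hrm]

theorem exists_cyclotomicAut_multiset_sum {M : ℕ} [NeZero M] (s : Multiset ℂ)
    (hs : ∀ z ∈ s, z ^ M = 1) :
    ∃ hx : s.sum ∈ cyclotomicSubfield M, ∀ t (ht : t.Coprime M),
      ((cyclotomicAut M t ht ⟨s.sum, hx⟩ : cyclotomicSubfield M) : ℂ) = (s.map (· ^ t)).sum := by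
  induction s using Multiset.induction_on with
  | empty => exact ⟨by simp, fun t ht => congrArg Subtype.val (map_zero (cyclotomicAut M t ht))⟩
  | cons z s ih =>
    obtain ⟨hx, ih⟩ := ih fun w hw => hs w (Multiset.mem_cons_of_mem hw)
    have hz1 := hs z (Multiset.mem_cons_self z s)
    have hz := mem_cyclotomicSubfield_of_pow_eq_one hz1
    refine ⟨by rw [Multiset.sum_cons]; exact add_mem hz hx, fun t ht => ?_⟩
    have h1 : cyclotomicAut M t ht ⟨z, hz⟩ = ⟨z, hz⟩ ^ t :=
      cyclotomicAut_apply ht (Subtype.ext hz1)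
    have h2 := map_add (cyclotomicAut M t ht) ⟨z, hz⟩ ⟨s.sum, hx⟩
    rw [h1] at h2
    have h3 := congrArg Subtype.val h2
    simp only [Multiset.map_cons, Multiset.sum_cons]
    rw [← ih t ht]
    exact h3

/-- Both sides are the image of the common sum under ζ_M ↦ ζ_M^t. This permits comparing the
eigenvalue multisets of one group element obtained from different primes. -/
theorem multiset_sum_map_pow_eq_of_sum_eq {M t : ℕ} [NeZero M] (ht : t.Coprime M)
    {s s' : Multiset ℂ} (hs : ∀ z ∈ s, z ^ M = 1) (hs' : ∀ z ∈ s', z ^ M = 1)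
    (h : s.sum = s'.sum) : (s.map (· ^ t)).sum = (s'.map (· ^ t)).sum := by
  obtain ⟨hx, key⟩ := exists_cyclotomicAut_multiset_sum s hs
  obtain ⟨hx', key'⟩ := exists_cyclotomicAut_multiset_sum s' hs'
  rw [← key t ht, ← key' t ht]
  congr 3

/-- Criterion for a sum of `N`-th roots of unity to lie in `ℚ(ζ_n)`. -/
theorem multiset_sum_mem_cyclotomicSubfield_iff {n N : ℕ} (hn : n ≠ 0) (hN : N ≠ 0)
    (s : Multiset ℂ) (hs : ∀ z ∈ s, z ^ N = 1) :
    s.sum ∈ cyclotomicSubfield n ↔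
      ∀ t : ℕ, t.Coprime (n * N) → t ≡ 1 [MOD n] → (s.map (· ^ t)).sum = s.sum := by
  have : NeZero (n * N) := ⟨mul_ne_zero hn hN⟩
  obtain ⟨hx, key⟩ := exists_cyclotomicAut_multiset_sum (M := n * N) s
    fun z hz => by rw [mul_comm, pow_mul, hs z hz, one_pow]
  rw [mem_cyclotomicSubfield_iff_fixed (Dvd.intro N rfl) ⟨s.sum, hx⟩]
  refine forall_congr' fun t => forall_congr' fun ht => imp_congr_right fun _ => ?_
  rw [← key t ht, Subtype.ext_iff]

/-! ### Eigenvalues and Brauer characters -/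

theorem liftRoot_coe {k : Type*} [Field k] {N : ℕ} (φ : rootsOfUnity N k →* ℂˣ)
    (u : rootsOfUnity N k) : liftRoot φ ((u : kˣ) : k) = φ u := by
  have h : ∃ v : rootsOfUnity N k, ((v : kˣ) : k) = ((u : kˣ) : k) := ⟨u, rfl⟩
  rw [liftRoot, dif_pos h, Subtype.ext (Units.ext h.choose_spec)]

/-- The eigenvalues of a matrix of finite order `N`, as a multiset of `N`-th roots of unity. -/
theorem exists_multiset_rootsOfUnity {k : Type*} [Field k] {N d : ℕ} [NeZero N]
    {M : Matrix (Fin d) (Fin d) k} (hM : M ^ N = 1) :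
    ∃ m : Multiset (rootsOfUnity N k), M.charpoly.roots = m.map fun u : rootsOfUnity N k => ((u : kˣ) : k) := by
  have hroot : ∀ x ∈ M.charpoly.roots, ∃ u : rootsOfUnity N k, ((u : kˣ) : k) = x := by
    intro x hx
    have h1 : x ∈ spectrum k M :=
      Matrix.mem_spectrum_iff_isRoot_charpoly.mpr (Polynomial.isRoot_of_mem_roots hx)
    have h2 := spectrum.pow_mem_pow M N h1
    rw [hM] at h2
    rcases subsingleton_or_nontrivial (Matrix (Fin d) (Fin d) k) with hs | hs
    · rw [spectrum.of_subsingleton] at h1; exact h1.elim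
    · rw [spectrum.one_eq, Set.mem_singleton_iff] at h2
      exact ⟨rootsOfUnity.mkOfPowEq x h2, rfl⟩
  generalize M.charpoly.roots = s at hroot
  induction s using Multiset.induction_on with
  | empty => exact ⟨0, rfl⟩
  | cons x s ih =>
    obtain ⟨m, hm⟩ := ih fun y hy => hroot y (Multiset.mem_cons_of_mem hy)
    obtain ⟨u, hu⟩ := hroot x (Multiset.mem_cons_self x s)
    exact ⟨u ::ₘ m, by rw [Multiset.map_cons, hu, hm]⟩

theorem pow_eq_one_of_mem_map_rootsOfUnity {k : Type*} [Field k] {N : ℕ}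
    (φ : rootsOfUnity N k →* ℂˣ) (m : Multiset (rootsOfUnity N k)) :
    ∀ z ∈ m.map (fun u => (φ u : ℂ)), z ^ N = 1 := by
  intro z hz
  obtain ⟨u, -, rfl⟩ := Multiset.mem_map.mp hz
  have hu : u ^ N = 1 := Subtype.ext ((mem_rootsOfUnity N _).mp u.2)
  rw [← Units.val_pow_eq_pow_val, ← map_pow, hu, map_one, Units.val_one]

theorem exists_eigenvalues {H k : Type*} [Group H] [Finite H] [Field k] {d : ℕ}
    (φ : rootsOfUnity (Nat.card H) k →* ℂˣ) (ρ : H →* GL (Fin d) k) (h : H) :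
    ∃ m : Multiset (rootsOfUnity (Nat.card H) k),
      (ρ h : Matrix (Fin d) (Fin d) k).charpoly.roots = m.map (fun u : rootsOfUnity (Nat.card H) k => ((u : kˣ) : k)) ∧
      brauerCharacter φ ρ h = (m.map fun u => (φ u : ℂ)).sum := by
  have : NeZero (Nat.card H) := ⟨Nat.card_pos.ne'⟩
  obtain ⟨m, hm⟩ := exists_multiset_rootsOfUnity (M := (ρ h : Matrix (Fin d) (Fin d) k))
    (N := Nat.card H) (by rw [← Units.val_pow_eq_pow_val, ← map_pow, pow_card_eq_one', map_one]; rfl)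
  refine ⟨m, hm, ?_⟩
  rw [brauerCharacter, hm, Multiset.map_map]
  simp only [Function.comp_def, liftRoot_coe]

theorem map_sum_rootsOfUnity {k : Type*} [Field k] {N : ℕ} {φ : rootsOfUnity N k →* ℂˣ}
    {A : Subalgebra ℤ ℂ} {f : A →+* k}
    (hf : ∀ u : rootsOfUnity N k, ∃ hu : (φ u : ℂ) ∈ A, f ⟨φ u, hu⟩ = ((u : kˣ) : k))
    (m : Multiset (rootsOfUnity N k)) :
    ∃ hm : (m.map fun u => (φ u : ℂ)).sum ∈ A,
      f ⟨_, hm⟩ = (m.map fun u : rootsOfUnity N k => ((u : kˣ) : k)).sum := by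
  induction m using Multiset.induction_on with
  | empty => exact ⟨by simp, map_zero f⟩
  | cons u m ih =>
    obtain ⟨hm, ih⟩ := ih
    obtain ⟨hu, hfu⟩ := hf u
    refine ⟨by rw [Multiset.map_cons, Multiset.sum_cons]; exact add_mem hu hm, ?_⟩
    have := map_add f ⟨_, hu⟩ ⟨_, hm⟩
    rw [hfu, ih] at this
    simp only [Multiset.map_cons, Multiset.sum_cons]
    exact this

/-- The trace of a representation is the reduction of its Brauer character. -/
theorem trace_eq_of_brauerCharacter {H k : Type*} [Group H] [Finite H] [Field k] [IsAlgClosed k]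
    {d : ℕ} {φ : rootsOfUnity (Nat.card H) k →* ℂˣ} {A : Subalgebra ℤ ℂ} {f : A →+* k}
    (hf : ∀ u : rootsOfUnity (Nat.card H) k, ∃ hu : (φ u : ℂ) ∈ A, f ⟨φ u, hu⟩ = ((u : kˣ) : k))
    (ρ : H →* GL (Fin d) k) (h : H) (a : A) (ha : brauerCharacter φ ρ h = a) :
    (ρ h : Matrix (Fin d) (Fin d) k).trace = f a := by
  obtain ⟨m, hm, hB⟩ := exists_eigenvalues φ ρ h
  obtain ⟨hmA, hfm⟩ := map_sum_rootsOfUnity hf m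
  rw [Matrix.trace_eq_sum_roots_charpoly, hm, ← hfm]
  congr 1
  exact Subtype.ext (hB.symm.trans ha)

/-- If the reductions of the eigenvalues of `ρ h` lift back to complex eigenvalues of `C`, then the
Brauer character is the trace of `C`. -/
theorem brauerCharacter_eq_trace_of_reduction {H k : Type*} [Group H] [Finite H] [Field k]
    [IsAlgClosed k] {d : ℕ} {φ : rootsOfUnity (Nat.card H) k →* ℂˣ}
    (hφ : ∀ z : ℂ, z ^ Nat.card H = 1 → ∃ u, (φ u : ℂ) = z) {A : Subalgebra ℤ ℂ} {f : A →+* k}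
    (hf : ∀ u : rootsOfUnity (Nat.card H) k, ∃ hu : (φ u : ℂ) ∈ A, f ⟨φ u, hu⟩ = ((u : kˣ) : k))
    (S : H →* Matrix (Fin d) (Fin d) A) (ρ : H →* GL (Fin d) k)
    (hρ : ∀ h, (ρ h : Matrix (Fin d) (Fin d) k) = f.mapMatrix (S h)) (h : H) :
    brauerCharacter φ ρ h = ((S h).trace : A) := by
  have : NeZero (Nat.card H) := ⟨Nat.card_pos.ne'⟩
  let C : Matrix (Fin d) (Fin d) ℂ := A.val.toRingHom.mapMatrix (S h)
  have hCpow : C ^ Nat.card H = 1 := by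
    rw [← map_pow, ← map_pow, pow_card_eq_one', map_one, map_one]
  obtain ⟨m₀, hm₀⟩ := exists_multiset_rootsOfUnity hCpow
  obtain ⟨m, hm⟩ : ∃ m : Multiset (rootsOfUnity (Nat.card H) k),
      C.charpoly.roots = m.map fun u => (φ u : ℂ) := by
    choose l hl using fun v : rootsOfUnity (Nat.card H) ℂ => hφ ((v : ℂˣ) : ℂ)
      (congrArg Units.val ((mem_rootsOfUnity _ _).mp v.2))
    refine ⟨m₀.map l, ?_⟩
    rw [hm₀, Multiset.map_map]
    simp only [Function.comp_def, hl]
  choose hA hfA using hf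
  let c : rootsOfUnity (Nat.card H) k → A := fun u => ⟨φ u, hA u⟩
  have hchar : (S h).charpoly = (m.map fun u => Polynomial.X - Polynomial.C (c u)).prod := by
    apply Polynomial.map_injective A.val.toRingHom Subtype.val_injective
    rw [← Matrix.charpoly_map, Polynomial.map_multiset_prod, Multiset.map_map]
    have h1 := (IsAlgClosed.splits C.charpoly).eq_prod_roots_of_monic (Matrix.charpoly_monic C)
    refine h1.trans ?_
    rw [hm, Multiset.map_map]
    congr 1
    refine Multiset.map_congr rfl fun u _ => ?_
    simp only [Function.comp_apply, Polynomial.map_sub, Polynomial.map_X, Polynomial.map_C]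
    rfl
  have hroots : (ρ h : Matrix (Fin d) (Fin d) k).charpoly.roots =
      m.map fun u : rootsOfUnity (Nat.card H) k => ((u : kˣ) : k) := by
    have h1 : (ρ h : Matrix (Fin d) (Fin d) k).charpoly =
        (m.map fun u : rootsOfUnity (Nat.card H) k =>
          Polynomial.X - Polynomial.C ((u : kˣ) : k)).prod := by
      rw [hρ, RingHom.mapMatrix_apply, Matrix.charpoly_map, hchar, Polynomial.map_multiset_prod,
        Multiset.map_map]
      congr 1
      refine Multiset.map_congr rfl fun u _ => ?_
      simp only [Function.comp_apply, Polynomial.map_sub, Polynomial.map_X, Polynomial.map_C]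
      rw [hfA]
    have h2 : (m.map fun u : rootsOfUnity (Nat.card H) k =>
        Polynomial.X - Polynomial.C ((u : kˣ) : k)) =
        (m.map fun u : rootsOfUnity (Nat.card H) k => ((u : kˣ) : k)).map
          fun a => Polynomial.X - Polynomial.C a := by
      rw [Multiset.map_map]; rfl
    rw [h1, h2, Polynomial.roots_multiset_prod_X_sub_C]
  rw [brauerCharacter, hroots, Multiset.map_map]
  simp only [Function.comp_def, liftRoot_coe]
  rw [← hm, ← Matrix.trace_eq_sum_roots_charpoly]
  exact (AddMonoidHom.map_trace A.val.toRingHom.toAddMonoidHom (S h)).symm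

/-- Injectivity sends a primitive N-th root to a primitive N-th root, whose powers exhaust the N-th
roots of unity in ℂ. -/
theorem exists_rootsOfUnity_eq {k : Type*} [Field k] [IsAlgClosed k] {p : ℕ} [Fact p.Prime]
    [CharP k p] {N : ℕ} (hp : ¬ p ∣ N) (φ : rootsOfUnity N k →* ℂˣ) (hφ : Function.Injective φ)
    (z : ℂ) (hz : z ^ N = 1) : ∃ u, (φ u : ℂ) = z := by
  have : NeZero N := ⟨by rintro rfl; simp at hp⟩
  obtain ⟨u₀, hu₀⟩ := exists_isPrimitiveRoot_of_not_dvd (k := k) hp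
  have hw : IsPrimitiveRoot hu₀.toRootsOfUnity N := by
    rw [← IsPrimitiveRoot.coe_submonoidClass_iff, ← IsPrimitiveRoot.coe_units_iff]
    exact hu₀
  have hζ : IsPrimitiveRoot (φ hu₀.toRootsOfUnity : ℂ) N :=
    IsPrimitiveRoot.coe_units_iff.mpr (hw.map_of_injective hφ)
  obtain ⟨i, -, hi⟩ := hζ.eq_pow_of_pow_eq_one hz
  exact ⟨hu₀.toRootsOfUnity ^ i, by rw [map_pow]; exact hi⟩

/-- An irreducible complex character is the Brauer character of a full representation in any
characteristic not dividing the group order. -/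
theorem exists_full_representation_of_irreducible {H : Type*} [Group H] [Fintype H] {d : ℕ}
    (σ : Representation ℂ H (Fin d → ℂ)) (hσ : σ.IsIrreducible) {k : Type*} [Field k]
    [IsAlgClosed k] {p : ℕ} [Fact p.Prime] [CharP k p] (hp : ¬ p ∣ Nat.card H)
    (φ : rootsOfUnity (Nat.card H) k →* ℂˣ) (hφ : Function.Injective φ) :
    ∃ (A : Subalgebra ℤ ℂ) (f : A →+* k) (S : H →* GL (Fin d) k), IsFullRepresentation S ∧
      (∀ u : rootsOfUnity (Nat.card H) k, ∃ hu : (φ u : ℂ) ∈ A, f ⟨φ u, hu⟩ = ((u : kˣ) : k)) ∧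
      (∀ h, σ.character h ∈ A) ∧ brauerCharacter φ S = σ.character ∧
      ∑ h, (S h : Matrix (Fin d) (Fin d) k).trace * (S h⁻¹ : Matrix (Fin d) (Fin d) k).trace ≠ 0 := by
  classical
  obtain ⟨b, A, f, S₀, hS₀, hf⟩ := exists_reduction hp φ hφ σ
  have hd : d ≠ 0 := by
    rintro rfl
    have h1 := (Representation.irreducible_iff_isSimpleModule_asModule σ).mp hσ
    have h2 : Nontrivial (Fin 0 → ℂ) := IsSimpleModule.nontrivial (MonoidAlgebra ℂ H) σ.asModule
    exact not_subsingleton (Fin 0 → ℂ) inferInstance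
  have hcard : (Fintype.card H : k) ≠ 0 := by
    rw [← Nat.card_eq_fintype_card, Ne, CharP.cast_eq_zero_iff k p]
    exact hp
  let ι : Matrix (Fin d) (Fin d) A →+* Matrix (Fin d) (Fin d) ℂ := A.val.toRingHom.mapMatrix
  have hιinj : Function.Injective ι := Matrix.map_injective Subtype.val_injective
  have hι : ∀ h, ι (S₀ h) = LinearMap.toMatrix b b (σ h) := hS₀
  let C : H →* Matrix (Fin d) (Fin d) ℂ := (ι : _ →* _).comp S₀
  have hC : ∀ h, C h = LinearMap.toMatrix b b (σ h) := hS₀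
  have hschur : ∀ X, (∀ h, X * C h = C h * X) → ∃ c : ℂ, X = c • (1 : Matrix (Fin d) (Fin d) ℂ) := by
    intro X hX
    obtain ⟨c, hc⟩ := hσ.exists_eq_smul_id (Matrix.toLin b b X) (by
      intro h
      apply (LinearMap.toMatrix b b).injective
      rw [LinearMap.toMatrix_comp b b b, LinearMap.toMatrix_comp b b b, LinearMap.toMatrix_toLin,
        ← hC]
      exact hX h)
    refine ⟨c, ?_⟩
    rw [← LinearMap.toMatrix_toLin b b X, hc, map_smul, LinearMap.toMatrix_id]
  have htrι : ∀ M : Matrix (Fin d) (Fin d) A, (ι M).trace = (M.trace : A) := fun M =>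
    (AddMonoidHom.map_trace A.val.toRingHom.toAddMonoidHom M).symm
  have hchar : ∀ h, σ.character h = ((S₀ h).trace : A) := by
    intro h
    rw [← htrι, hι, Representation.character, LinearMap.trace_eq_matrix_trace ℂ b]
  -- All terms lie in A, so orthogonality descends from ℂ and can be pushed through f. Applied to
  -- elementary matrices it gives fullness, since |H| is invertible in k; d need not be.
  have hortho : ∀ E : Matrix (Fin d) (Fin d) A, (Fintype.card H : A) • E =
      (d : A) • ∑ h, (S₀ h⁻¹ * E).trace • S₀ h := by
    intro E
    have hsm : ∀ (a : A) (M : Matrix (Fin d) (Fin d) A), ι (a • M) = (a : ℂ) • ι M := by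
      intro a M; ext i j; rfl
    apply hιinj
    rw [hsm, hsm, map_sum]
    simp only [hsm, ← htrι, map_mul]
    have := card_smul_eq_sum_trace_smul C hschur (ι E)
    have hCι : ∀ h, C h = ι (S₀ h) := fun h => rfl
    simp only [hCι] at this
    simpa using this
  let S : H →* GL (Fin d) k := ((f.mapMatrix (m := Fin d)).toMonoidHom.comp S₀).toHomUnits
  have hS : ∀ h, (S h : Matrix (Fin d) (Fin d) k) = f.mapMatrix (S₀ h) := fun h => rfl
  have htrf : ∀ M : Matrix (Fin d) (Fin d) A, (f.mapMatrix M).trace = f M.trace := fun M =>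
    (AddMonoidHom.map_trace f.toAddMonoidHom M).symm
  refine ⟨A, f, S, ?_, hf, fun h => hchar h ▸ Subtype.property _, ?_, ?_⟩
  · rw [IsFullRepresentation, eq_top_iff]
    rintro E -
    rw [Matrix.matrix_eq_sum_single E]
    refine sum_mem fun i _ => sum_mem fun j _ => ?_
    rw [← mul_one (E i j), ← smul_eq_mul, ← Matrix.smul_single]
    refine Submodule.smul_mem _ _ ((Submodule.smul_mem_iff _ hcard).mp ?_)
    have hsm : ∀ (a : A) (M : Matrix (Fin d) (Fin d) A),
        f.mapMatrix (a • M) = f a • f.mapMatrix M := by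
      intro a M; ext i j; simp
    have h1 := congrArg f.mapMatrix (hortho (Matrix.single i j 1))
    rw [hsm, hsm, map_sum, map_natCast] at h1
    have h2 : f.mapMatrix (Matrix.single i j (1 : A)) = Matrix.single i j (1 : k) := by
      rw [RingHom.mapMatrix_apply, Matrix.map_single _ _ _ f, map_one]
    rw [h2] at h1
    rw [h1]
    refine Submodule.smul_mem _ _ (sum_mem fun h _ => ?_)
    rw [hsm]
    exact Submodule.smul_mem _ _ (Submodule.subset_span ⟨h, rfl⟩)
  · ext h
    rw [hchar]
    exact brauerCharacter_eq_trace_of_reduction (exists_rootsOfUnity_eq hp φ hφ) hf S₀ S hS h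
  · have h1 : ∑ h, (S₀ h).trace * (S₀ h⁻¹).trace = (Fintype.card H : A) := by
      apply Subtype.val_injective
      have := sum_trace_mul_trace_inv hd C hschur
      have h2 : ∀ h, (C h).trace = ((S₀ h).trace : A) := fun h => htrι _
      simp only [h2] at this
      push_cast
      simpa using this
    have h3 : ∑ h, (S h : Matrix (Fin d) (Fin d) k).trace *
        (S h⁻¹ : Matrix (Fin d) (Fin d) k).trace = Fintype.card H := by
      simp only [hS, htrf]
      rw [← map_natCast f, ← h1, map_sum]
      simp only [map_mul]
    rw [h3]
    exact hcard

theorem brauerCharacter_one {H k : Type*} [Group H] [Field k]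
    (φ : rootsOfUnity (Nat.card H) k →* ℂˣ) {d : ℕ} (ρ : H →* GL (Fin d) k) :
    brauerCharacter φ ρ 1 = d := by
  have h1 : liftRoot φ (1 : k) = 1 := by
    have := liftRoot_coe φ 1
    simpa using this
  rw [brauerCharacter, map_one, Units.val_one, Matrix.charpoly_one]
  rw [show (Polynomial.X - 1 : Polynomial k) = Polynomial.X - Polynomial.C 1 by simp,
    Polynomial.roots_pow, Polynomial.roots_X_sub_C]
  rw [Multiset.map_nsmul, Multiset.map_singleton, h1, Multiset.sum_nsmul]
  simp

theorem trace_generalLinearGroup_map {k k' : Type*} [Field k] [Field k'] {d : ℕ} (F : k →+* k')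
    (x : GL (Fin d) k) : (Matrix.GeneralLinearGroup.map F x : Matrix (Fin d) (Fin d) k').trace =
      F (x : Matrix (Fin d) (Fin d) k).trace :=
  (AddMonoidHom.map_trace F.toAddMonoidHom _).symm

/-- The Brauer character of a representation conjugate into `GL_d(q)` is invariant under raising
all eigenvalues to the power `q`. -/
theorem sum_pow_eq_of_conj_mem_generalLinearOfOrder {k : Type*} [Field k]
    [IsAlgClosed k] {p : ℕ} [Fact p.Prime] [CharP k p] {a d : ℕ} {N : ℕ}
    (φ : rootsOfUnity N k →* ℂˣ) (x g : GL (Fin d) k)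
    (hg : g * x * g⁻¹ ∈ generalLinearOfOrder k p a d) (m : Multiset (rootsOfUnity N k))
    (hm : (x : Matrix (Fin d) (Fin d) k).charpoly.roots =
      m.map fun u : rootsOfUnity N k => ((u : kˣ) : k)) :
    (m.map fun u => (φ u : ℂ) ^ p ^ a).sum = (m.map fun u => (φ u : ℂ)).sum := by
  let F := iterateFrobenius k p a
  rw [mem_generalLinearOfOrder_iff] at hg
  have h1 : (g * x * g⁻¹ : GL (Fin d) k).val.charpoly = x.val.charpoly := by
    rw [Units.val_mul, Units.val_mul, Matrix.charpoly_mul_comm, ← Matrix.mul_assoc,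
      ← Units.val_mul, inv_mul_cancel, Units.val_one, Matrix.one_mul]
  have h2 : x.val.charpoly.map F = x.val.charpoly := by
    rw [← h1]
    conv_rhs => rw [← hg]
    exact (Matrix.charpoly_map _ F).symm
  have h3 : x.val.charpoly.roots.map F = x.val.charpoly.roots := by
    conv_rhs => rw [← h2]
    exact ((IsAlgClosed.splits x.val.charpoly).roots_map F).symm
  rw [hm, Multiset.map_map] at h3
  have h4 : (m.map (· ^ p ^ a)).map (fun u : rootsOfUnity N k => ((u : kˣ) : k)) =
      m.map fun u : rootsOfUnity N k => ((u : kˣ) : k) := by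
    rw [Multiset.map_map, ← h3]
    refine Multiset.map_congr rfl fun u _ => ?_
    simp [F, iterateFrobenius_def]
  have h5 := Multiset.map_injective
    (fun u v h => Subtype.ext (Units.ext h) : Function.Injective
      fun u : rootsOfUnity N k => ((u : kˣ) : k)) h4
  conv_rhs => rw [← h5]
  rw [Multiset.map_map]
  simp

/-! ### Distinguishing moduli and fields of values -/

theorem isDistinguishingModulus_of_mem_cyclotomicSubfield {H : Type*} [Group H] [Finite H]
    {χ : H → ℂ} (hχ : IsIrreducibleCharacter χ) {k : Nat.Primes → Type*} [∀ p, Field (k p)]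
    [∀ p, IsAlgClosed (k p)] [∀ p, CharP (k p) p]
    {φ : ∀ p, rootsOfUnity (Nat.card H) (k p) →* ℂˣ}
    (hφ : ∀ p : Nat.Primes, ¬ (p : ℕ) ∣ Nat.card H → Function.Injective (φ p)) {n : ℕ} (hn : 0 < n)
    (hmem : ∀ h, χ h ∈ cyclotomicSubfield n) : IsDistinguishingModulus k φ χ n := by
  refine ⟨hn, fun p a ha hp hq d ρ hρ => ?_⟩
  have := Fintype.ofFinite H
  obtain ⟨d', σ, hσ, rfl⟩ := hχ
  obtain ⟨A, f, S, hfull, hf, hA, hS, hne⟩ :=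
    exists_full_representation_of_irreducible σ hσ hp (φ p) (hφ p hp)
  obtain rfl : d = d' := by
    have h1 := (congrFun hρ 1).trans (congrFun hS 1).symm
    rw [brauerCharacter_one, brauerCharacter_one] at h1
    exact_mod_cast h1
  have htrS : ∀ h, (S h : Matrix (Fin d) (Fin d) (k p)).trace = f ⟨_, hA h⟩ := fun h =>
    trace_eq_of_brauerCharacter hf S h ⟨_, hA h⟩ (congrFun hS h)
  have htrρ : ∀ h, (ρ h : Matrix (Fin d) (Fin d) (k p)).trace = f ⟨_, hA h⟩ := fun h =>
    trace_eq_of_brauerCharacter hf ρ h ⟨_, hA h⟩ (congrFun hρ h)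
  obtain ⟨g₁, hg₁⟩ := hfull.exists_conj_eq ρ (by simpa only [htrS, htrρ] using hne)
  let F := iterateFrobenius (k p) p a
  -- Frobenius raises eigenvalues to the power q, and the lifted sum of q-th powers equals χ(h)
  -- because q ≡ 1 mod n.
  have hfix : ∀ h, F (S h : Matrix (Fin d) (Fin d) (k p)).trace =
      (S h : Matrix (Fin d) (Fin d) (k p)).trace := by
    intro h
    obtain ⟨m, hm, hB⟩ := exists_eigenvalues (φ p) S h
    have hpow := pow_eq_one_of_mem_map_rootsOfUnity (φ p) m
    have hcop : ((p : ℕ) ^ a).Coprime (n * Nat.card H) := by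
      refine Nat.Coprime.mul_right ?_ (((Nat.Prime.coprime_iff_not_dvd p.2).mpr hp).pow_left a)
      rw [Nat.Coprime, hq.gcd_eq, Nat.gcd_one_left]
    have hmemh := hmem h
    rw [← congrFun hS h, hB, multiset_sum_mem_cyclotomicSubfield_iff hn.ne' Nat.card_pos.ne' _ hpow]
      at hmemh
    have hsum := hmemh _ hcop hq
    obtain ⟨h₁, h₂⟩ := map_sum_rootsOfUnity hf m
    obtain ⟨h₃, h₄⟩ := map_sum_rootsOfUnity hf (m.map (· ^ (p : ℕ) ^ a))
    have heq : ((m.map (· ^ (p : ℕ) ^ a)).map fun u => (φ p u : ℂ)).sum =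
        (m.map fun u => (φ p u : ℂ)).sum := by
      rw [← hsum, Multiset.map_map, Multiset.map_map]
      simp
    have h₅ : (m.map fun u : rootsOfUnity (Nat.card H) (k p) => ((u : (k p)ˣ) : k p)).sum =
        ((m.map (· ^ (p : ℕ) ^ a)).map
          fun u : rootsOfUnity (Nat.card H) (k p) => ((u : (k p)ˣ) : k p)).sum := by
      rw [← h₂, ← h₄]
      exact congrArg f (Subtype.ext heq.symm)
    rw [Matrix.trace_eq_sum_roots_charpoly, hm]
    conv_rhs => rw [h₅]
    rw [map_multiset_sum, Multiset.map_map, Multiset.map_map]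
    exact congrArg Multiset.sum (Multiset.map_congr rfl fun u _ => iterateFrobenius_def _ _ _)
  obtain ⟨T, hT⟩ := hfull.exists_conj_eq ((Matrix.GeneralLinearGroup.map F).comp S) (by
    have : ∀ h, (((Matrix.GeneralLinearGroup.map F).comp S) h : Matrix (Fin d) (Fin d) (k p)).trace
        = (S h : Matrix (Fin d) (Fin d) (k p)).trace := fun h =>
      (trace_generalLinearGroup_map F (S h)).trans (hfix h)
    simpa only [this] using hne)
  obtain ⟨g₂, hg₂⟩ := hfull.exists_conj_mem_generalLinearOfOrder ha T hT
  refine ⟨g₂ * g₁⁻¹, fun h => ?_⟩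
  have : g₂ * g₁⁻¹ * ρ h * (g₂ * g₁⁻¹)⁻¹ = g₂ * S h * g₂⁻¹ := by
    rw [← hg₁]; group
  rw [this]
  exact hg₂ h

theorem mem_cyclotomicSubfield_of_isDistinguishingModulus {H : Type*} [Group H] [Finite H]
    {χ : H → ℂ} (hχ : IsIrreducibleCharacter χ) {k : Nat.Primes → Type*} [∀ p, Field (k p)]
    [∀ p, IsAlgClosed (k p)] [∀ p, CharP (k p) p]
    {φ : ∀ p, rootsOfUnity (Nat.card H) (k p) →* ℂˣ}
    (hφ : ∀ p : Nat.Primes, ¬ (p : ℕ) ∣ Nat.card H → Function.Injective (φ p)) {n : ℕ}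
    (hdist : IsDistinguishingModulus k φ χ n) (h : H) : χ h ∈ cyclotomicSubfield n := by
  obtain ⟨hn, hdist⟩ := hdist
  have := Fintype.ofFinite H
  obtain ⟨d, σ, hσ, rfl⟩ := hχ
  -- Dirichlet's theorem; choosing p > |H| ensures p ∤ |H|.
  have key : ∀ t : ℕ, t.Coprime (n * Nat.card H) → ∃ p : Nat.Primes, ¬ (p : ℕ) ∣ Nat.card H ∧
      (p : ℕ) ≡ t [MOD n * Nat.card H] := by
    intro t ht
    have : NeZero (n * Nat.card H) := ⟨mul_ne_zero hn.ne' Nat.card_pos.ne'⟩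
    obtain ⟨p, hpgt, hp, hpt⟩ := Nat.forall_exists_prime_gt_and_eq_mod
      ((ZMod.isUnit_iff_coprime t (n * Nat.card H)).mpr ht) (Nat.card H)
    exact ⟨⟨p, hp⟩, fun hdvd => (Nat.le_of_dvd Nat.card_pos hdvd).not_gt hpgt,
      (ZMod.natCast_eq_natCast_iff _ _ _).mp hpt⟩
  have eigen : ∀ p : Nat.Primes, ¬ (p : ℕ) ∣ Nat.card H → ∃ s : Multiset ℂ,
      (∀ z ∈ s, z ^ Nat.card H = 1) ∧ s.sum = σ.character h ∧
      ((p : ℕ) ≡ 1 [MOD n] → (s.map (· ^ (p : ℕ))).sum = s.sum) := by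
    intro p hp
    obtain ⟨A, f, S, hfull, hf, hA, hS, hne⟩ :=
      exists_full_representation_of_irreducible σ hσ hp (φ p) (hφ p hp)
    obtain ⟨m, hm, hB⟩ := exists_eigenvalues (φ p) S h
    refine ⟨m.map fun u => (φ p u : ℂ), pow_eq_one_of_mem_map_rootsOfUnity (φ p) m,
      hB.symm.trans (congrFun hS h), fun hp1 => ?_⟩
    -- Prime fields suffice here: only a = 1 is used.
    obtain ⟨g, hg⟩ := hdist p 1 one_pos hp (by rwa [pow_one]) d S hS
    have := sum_pow_eq_of_conj_mem_generalLinearOfOrder (φ p) (S h) g (hg h) m hm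
    rw [pow_one] at this
    rw [Multiset.map_map]
    exact this
  have hM : NeZero (n * Nat.card H) := ⟨mul_ne_zero hn.ne' Nat.card_pos.ne'⟩
  have hpowM : ∀ s : Multiset ℂ, (∀ z ∈ s, z ^ Nat.card H = 1) →
      ∀ z ∈ s, z ^ (n * Nat.card H) = 1 := fun s hs z hz => by
    rw [mul_comm, pow_mul, hs z hz, one_pow]
  obtain ⟨p₀, hp₀, -⟩ := key 1 (Nat.coprime_one_left _)
  obtain ⟨s, hs, hsum, -⟩ := eigen p₀ hp₀
  rw [← hsum, multiset_sum_mem_cyclotomicSubfield_iff hn.ne' Nat.card_pos.ne' s hs]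
  intro t ht htn
  obtain ⟨p, hp, hpt⟩ := key t ht
  obtain ⟨s', hs', hsum', hpow⟩ := eigen p hp
  rw [multiset_sum_map_pow_eq_of_sum_eq ht (hpowM s hs) (hpowM s' hs') (hsum.trans hsum'.symm),
    hsum, ← hsum', ← hpow ((hpt.of_mul_right _).trans htn)]
  refine congrArg Multiset.sum (Multiset.map_congr rfl fun z hz => ?_)
  rw [← pow_mod_orderOf z t, ← pow_mod_orderOf z p]
  congr 1
  exact (hpt.of_dvd (orderOf_dvd_of_pow_eq_one (hpowM s' hs' z hz))).symm

theorem isDistinguishingModulus_iff {H : Type*} [Group H] [Finite H]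
    {χ : H → ℂ} (hχ : IsIrreducibleCharacter χ) {k : Nat.Primes → Type*} [∀ p, Field (k p)]
    [∀ p, IsAlgClosed (k p)] [∀ p, CharP (k p) p]
    {φ : ∀ p, rootsOfUnity (Nat.card H) (k p) →* ℂˣ}
    (hφ : ∀ p : Nat.Primes, ¬ (p : ℕ) ∣ Nat.card H → Function.Injective (φ p)) (n : ℕ) :
    IsDistinguishingModulus k φ χ n ↔ 0 < n ∧ ∀ h : H, χ h ∈ cyclotomicSubfield n :=
  ⟨fun hd => ⟨hd.1, mem_cyclotomicSubfield_of_isDistinguishingModulus hχ hφ hd⟩,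
    fun hd => isDistinguishingModulus_of_mem_cyclotomicSubfield hχ hφ hd.1 hd.2⟩

/-- The values of an irreducible character of `H` lie in the cyclotomic field of conductor `|H|`. -/
theorem IsIrreducibleCharacter.mem_cyclotomicSubfield_card {H : Type*} [Group H] [Finite H]
    {χ : H → ℂ} (hχ : IsIrreducibleCharacter χ) (h : H) :
    χ h ∈ cyclotomicSubfield (Nat.card H) := by
  have : NeZero (Nat.card H) := ⟨Nat.card_pos.ne'⟩
  obtain ⟨d, σ, -, rfl⟩ := hχ
  let M := LinearMap.toMatrix (Pi.basisFun ℂ (Fin d)) (Pi.basisFun ℂ (Fin d)) (σ h)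
  have hM : M ^ Nat.card H = 1 := by
    change LinearMap.toMatrix _ _ (σ h) ^ Nat.card H = 1
    rw [LinearMap.toMatrix_pow, ← map_pow, pow_card_eq_one', map_one, LinearMap.toMatrix_one]
  obtain ⟨m, hm⟩ := exists_multiset_rootsOfUnity hM
  rw [Representation.character, LinearMap.trace_eq_matrix_trace ℂ (Pi.basisFun ℂ (Fin d)),
    Matrix.trace_eq_sum_roots_charpoly, hm]
  refine multiset_sum_mem _ fun z hz => mem_cyclotomicSubfield_of_pow_eq_one ?_
  exact pow_eq_one_of_mem_map_rootsOfUnity (rootsOfUnity _ ℂ).subtype m z hz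

end

theorem lemma2p3 {H : Type*} [Group H] [Finite H] (χ : H → ℂ) (hχ : IsIrreducibleCharacter χ)
    (k : Nat.Primes → Type*) [∀ p, Field (k p)] [∀ p, IsAlgClosed (k p)] [∀ p, CharP (k p) p]
    (φ : ∀ p, rootsOfUnity (Nat.card H) (k p) →* ℂˣ)
    (hφ : ∀ p : Nat.Primes, ¬ (p : ℕ) ∣ Nat.card H → Function.Injective (φ p)) :
    (∀ n : ℕ, 0 < n →
      (IsDistinguishingModulus k φ χ n ↔ ∀ h : H, χ h ∈ cyclotomicSubfield n)) ∧
    (∃ n₀ : ℕ, IsLeast {n : ℕ | IsDistinguishingModulus k φ χ n} n₀ ∧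
      ∀ n : ℕ, IsDistinguishingModulus k φ χ n → n₀ ∣ n) ∧
    (∀ m : ℕ, 0 < m →
      (IsDistinguishingModulus k φ χ m ↔
        IsDistinguishingModulus k φ χ (Nat.gcd m (Nat.card H)))) := by
  classical
  have hiff := isDistinguishingModulus_iff (φ := φ) hχ hφ
  have hcard : IsDistinguishingModulus k φ χ (Nat.card H) :=
    (hiff _).mpr ⟨Nat.card_pos, hχ.mem_cyclotomicSubfield_card⟩
  have hgcd : ∀ m n, IsDistinguishingModulus k φ χ m → IsDistinguishingModulus k φ χ n →
      IsDistinguishingModulus k φ χ (m.gcd n) := by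
    intro m n hm hn
    rw [hiff] at hm hn ⊢
    exact ⟨Nat.gcd_pos_of_pos_left n hm.1,
      fun h => mem_cyclotomicSubfield_gcd hm.1.ne' hn.1.ne' (hm.2 h) (hn.2 h)⟩
  refine ⟨fun n hn => ?_, ?_, fun m hm => ⟨fun h => hgcd _ _ h hcard, fun h => ?_⟩⟩
  · rw [hiff, and_iff_right hn]
  · have hex : ∃ n, IsDistinguishingModulus k φ χ n := ⟨_, hcard⟩
    refine ⟨Nat.find hex, ⟨Nat.find_spec hex, fun n hn => Nat.find_min' hex hn⟩, fun n hn => ?_⟩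
    -- The gcd of the least modulus with n is again a modulus, so minimality makes it equal to the
    -- least one.
    have h1 := Nat.find_min' hex (hgcd _ _ (Nat.find_spec hex) hn)
    have h2 := Nat.le_of_dvd (Nat.find_spec hex).1 (Nat.gcd_dvd_left (Nat.find hex) n)
    exact Nat.gcd_eq_left_iff_dvd.mp (le_antisymm h2 h1)
  · rw [hiff] at h ⊢
    exact ⟨hm, fun x => cyclotomicSubfield_mono hm.ne' (Nat.gcd_dvd_left _ _) (h.2 x)⟩
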